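/- **Notation.** Let $\mathbb{S}=\{v\in\mathbb{H}: v^2=-1\}$, and for $v\in\mathbb S$ let $\rho_v(x+\iota y)=x+vy$, extended to $\mathbb{H}\otimes\mathbb{C}=\mathbb{C}^4$ by $\rho_v(z\otimes q)=\rho_v(z)q$. For $z=x+\iota y$ the sphere of $z$ is $[x+vy]=\{x+vy: v\in\mathbb S\}$ (a point if $y=0$). For an open set $\mathcal{D}\subseteq\mathbb{C}$ invariant under conjugation let $D=\{x+vy: x+\iota y\in\mathcal{D},\ v\in\mathbb S\}\subseteq\mathbb H$. A function $f:D\to\mathbb{H}$ is (left) slice-regular if $f(x+vy)=\alpha(x,y)+v\beta(x,y)$ with $\alpha,\beta:\mathcal{D}\to\mathbb{H}$ real differentiable, $\alpha$ even and $\beta$ odd in $y$, $\partial_x\alpha=\partial_y\beta$, $\partial_y\alpha=-\partial_x\beta$. Then $F=\alpha+\iota\beta:\mathcal{D}\to\mathbb{C}^4$ is the unique (holomorphic) map with $F(\bar z)=\overline{F(z)}$ and $f(x+vy)=\rho_v(F(x+\iota y))$. The $\star$-product of $f=\alpha+v\beta$ and $g=\gamma+v\delta$ is $(f\star g)(x+vy)=(\alpha\gamma-\beta\delta)+v(\alpha\delta+\beta\gamma)$.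 Put $\Phi(z_0,z_1,z_2,z_3)=z_0^2+z_1^2+z_2^2+z_3^2$. **Multiplicities.** On a sphere $S=[x+vy]$ with $y\neq0$, $f$ has spherical multiplicity $m_S$ and isolated multiplicity $n_S$ if $$f(q)=\big((q-x)^2+y^2\big)^{m_S}\,\big[(q-p_1)\star\cdots\star(q-p_{n_S})\star g\big](q)$$ with $g$ slice-regular on $D$ without zeros on $S$, $p_i\in S$ and $p_{i+1}\neq\overline{p_i}$. At a real point $x$ the isolated multiplicity is the $n$ with $f=(q-x)^{n}g$, $g$ slice-regular, $g(x)\ne0$, and the spherical multiplicity is $0$. **Theorem (Counting zeros – I).** Let $\mathcal{U}\subseteq\mathbb{C}$ be open and invariant under conjugation, and let $U=\{x+vy: x+\iota y\in\mathcal U,\ v\in\mathbb S\}$. Suppose that $b\mathcal U$ is rectifiable and positively oriented, i.e. it is the union of the images of a finite family $\Gamma$ of closed rectifiable curves which has total winding number $1$ around every point of $\mathcal U$ and $0$ around every point outside $\overline{\mathcal U}$; $\int_{b\mathcal U}$ denotes integration along $\Gamma$. Let $f$ be slice-regular on $D\supseteq\overline{U}$, with $D$ as above, and suppose that $f$ does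 not vanish on $bU$. Then $f$ has zeros on only finitely many spheres in $U$, on each of them the two multiplicities exist and are unique, and $$\frac{1}{2\pi\iota}\int_{b\mathcal U}\frac{(\Phi\circ F)'(z)}{(\Phi\circ F)(z)}\,dz=2k+4m,$$ where $k$ is the number of isolated (real or non-real) zeros of $f$ in $U$ counted with multiplicity, i.e. the sum of the isolated multiplicities over all spheres (including real points) in $U$ on which $f$ has a zero, and $m$ is the number of spherical zeros of $f$ in $U$ counted with multiplicity, i.e. the sum of the spherical multiplicities. -/

import Mathlib

open scoped Quaternion ComplexConjugate

noncomputable section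

namespace SliceRegular

/-! ### Spherically symmetric sets and slice-regular functions -/

/-- The `2`-sphere of quaternionic imaginary units. -/
def imagUnits : Set ℍ := {v | v ^ 2 = -1}

/-- `ρ_v (x + ι y) = π (x, y, v) = x + v y`. -/
def rho (v : ℍ) (z : ℂ) : ℍ := (z.re : ℍ) + v * (z.im : ℍ)

/-- The sphere `[x + v y] = {x + v y : v an imaginary unit}` of `z = x + ι y`
(a single point when `y = 0`). -/
def sphereOf (z : ℂ) : Set ℍ := {q | ∃ v ∈ imagUnits, q = rho v z}

/-- The spherically symmetric subset `π (D × 𝕊)` of `ℍ` over a set `D` in the plane. -/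
def circularization (D : Set ℂ) : Set ℍ := {q | ∃ z ∈ D, q ∈ sphereOf z}

/-- `f` is (left) slice-regular on `circularization D`: one has `f (x + v y) = α + v β`
with real differentiable `α`, `β`, respectively even and odd in `y`,
which solve the Cauchy-Riemann system. It is used for open `D` symmetric under conjugation. -/
def IsSliceRegularOn (D : Set ℂ) (f : ℍ → ℍ) : Prop :=
  ∃ α β : ℂ → ℍ, DifferentiableOn ℝ α D ∧ DifferentiableOn ℝ β D ∧
    ∀ z ∈ D,
      α (conj z) = α z ∧ β (conj z) = -β z ∧
      fderiv ℝ α z 1 = fderiv ℝ β z Complex.I ∧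
      fderiv ℝ α z Complex.I = -fderiv ℝ β z 1 ∧
      ∀ v ∈ imagUnits, f (rho v z) = α z + v * β z

/-! ### The holomorphic map `F` with values in `ℍ ⊗ ℂ = ℂ⁴`, and `Φ`

`Quaternion ℂ` is `ℍ ⊗ ℂ`, with the four complex coordinates `re, imI, imJ, imK`. -/

/-- The quaternionic unit `i`. -/
def unitI : ℍ := ⟨0, 1, 0, 0⟩
/-- The quaternionic unit `j`. -/
def unitJ : ℍ := ⟨0, 0, 1, 0⟩
/-- The quaternionic unit `k`. -/
def unitK : ℍ := ⟨0, 0, 0, 1⟩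

theorem unitI_re : unitI.re = 0 := rfl
theorem unitI_imI : unitI.imI = 1 := rfl
theorem unitI_imJ : unitI.imJ = 0 := rfl
theorem unitI_imK : unitI.imK = 0 := rfl
theorem unitJ_re : unitJ.re = 0 := rfl
theorem unitJ_imI : unitJ.imI = 0 := rfl
theorem unitJ_imJ : unitJ.imJ = 1 := rfl
theorem unitJ_imK : unitJ.imK = 0 := rfl
theorem unitK_re : unitK.re = 0 := rfl
theorem unitK_imI : unitK.imI = 0 := rfl
theorem unitK_imJ : unitK.imJ = 0 := rfl
theorem unitK_imK : unitK.imK = 1 := rfl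
attribute [local simp] unitI_re unitI_imI unitI_imJ unitI_imK unitJ_re unitJ_imI unitJ_imJ unitJ_imK unitK_re unitK_imI unitK_imJ unitK_imK

/-- The function `α` in `f (x + v y) = α (x, y) + v β (x, y)`, recovered from `f`. -/
def alphaPart (f : ℍ → ℍ) (z : ℂ) : ℍ :=
  (1 / 2 : ℝ) • (f (rho unitI z) + f (rho (-unitI) z))

/-- The function `β` in `f (x + v y) = α (x, y) + v β (x, y)`, recovered from `f`. -/
def betaPart (f : ℍ → ℍ) (z : ℂ) : ℍ :=
  (1 / 2 : ℝ) • (-unitI * (f (rho unitI z) - f (rho (-unitI) z)))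

theorem unitI_mem : unitI ∈ imagUnits := by
  rw [imagUnits, Set.mem_ofPred_eq, pow_two]
  ext <;> simp

theorem neg_unitI_mem : -unitI ∈ imagUnits := by
  rw [imagUnits, Set.mem_ofPred_eq, pow_two]
  ext <;> simp

theorem alphaPart_eq {f : ℍ → ℍ} {z : ℂ} {a b : ℍ}
    (h : ∀ v ∈ imagUnits, f (rho v z) = a + v * b) : alphaPart f z = a := by
  rw [alphaPart, h _ unitI_mem, h _ neg_unitI_mem, neg_mul, add_add_add_comm, add_neg_cancel,
    add_zero, ← two_smul ℝ a, smul_smul]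
  norm_num

theorem betaPart_eq {f : ℍ → ℍ} {z : ℂ} {a b : ℍ}
    (h : ∀ v ∈ imagUnits, f (rho v z) = a + v * b) : betaPart f z = b := by
  have hI : unitI * unitI = -1 := by simpa [imagUnits, pow_two] using unitI_mem
  have : -unitI * (a + unitI * b - (a + -unitI * b)) = (2 : ℝ) • b := by
    rw [show a + unitI * b - (a + -unitI * b) = unitI * b + unitI * b by noncomm_ring,
      mul_add, ← mul_assoc, neg_mul, hI, two_smul, neg_neg, one_mul]
  rw [betaPart, h _ unitI_mem, h _ neg_unitI_mem, this, smul_smul]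
  norm_num

/-- The real part `a` of `w = a + ι b` in `ℍ ⊗ ℂ`. -/
def reExt (w : Quaternion ℂ) : ℍ := ⟨w.re.re, w.imI.re, w.imJ.re, w.imK.re⟩
/-- The imaginary part `b` of `w = a + ι b` in `ℍ ⊗ ℂ`. -/
def imExt (w : Quaternion ℂ) : ℍ := ⟨w.re.im, w.imI.im, w.imJ.im, w.imK.im⟩

/-- The map `F = (f₀, f₁, f₂, f₃)`, `f_m = α_m + ι β_m`, attached to `f`
(see `stem_spec` and `stem_unique`). -/
def stem (f : ℍ → ℍ) (z : ℂ) : Quaternion ℂ :=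
  ⟨⟨(alphaPart f z).re, (betaPart f z).re⟩, ⟨(alphaPart f z).imI, (betaPart f z).imI⟩,
    ⟨(alphaPart f z).imJ, (betaPart f z).imJ⟩, ⟨(alphaPart f z).imK, (betaPart f z).imK⟩⟩

/-- The extension of `ρ_v` to `ℍ ⊗ ℂ`, `ρ_v (z ⊗ q) = ρ_v (z) q`. -/
def rhoExt (v : ℍ) (w : Quaternion ℂ) : ℍ :=
  rho v w.re + rho v w.imI * unitI + rho v w.imJ * unitJ + rho v w.imK * unitK

/-- Coordinatewise complex conjugation of `ℍ ⊗ ℂ = ℂ⁴`. -/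
def conjExt (w : Quaternion ℂ) : Quaternion ℂ :=
  ⟨conj w.re, conj w.imI, conj w.imJ, conj w.imK⟩

theorem rhoExt_eq (v : ℍ) (w : Quaternion ℂ) : rhoExt v w = reExt w + v * imExt w := by
  have r0 : (reExt w).re = w.re.re := rfl
  have r1 : (reExt w).imI = w.imI.re := rfl
  have r2 : (reExt w).imJ = w.imJ.re := rfl
  have r3 : (reExt w).imK = w.imK.re := rfl
  have i0 : (imExt w).re = w.re.im := rfl
  have i1 : (imExt w).imI = w.imI.im := rfl
  have i2 : (imExt w).imJ = w.imJ.im := rfl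
  have i3 : (imExt w).imK = w.imK.im := rfl
  ext <;> simp [rhoExt, rho, r0, r1, r2, r3, i0, i1, i2, i3] <;> ring

/-- `F (conj z) = conj (F z)` and `f (x + v y) = ρ_v (F (x + ι y))`. -/
theorem stem_spec {D : Set ℂ} (hD : ∀ z ∈ D, conj z ∈ D) {f : ℍ → ℍ}
    (hf : IsSliceRegularOn D f) {z : ℂ} (hz : z ∈ D) :
    stem f (conj z) = conjExt (stem f z) ∧
      ∀ v ∈ imagUnits, f (rho v z) = rhoExt v (stem f z) := by
  obtain ⟨α, β, -, -, h⟩ := hf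
  obtain ⟨h1, h2, -, -, h5⟩ := h z hz
  have h5' := (h _ (hD z hz)).2.2.2.2
  refine ⟨?_, fun v hv => ?_⟩
  · simp only [stem, alphaPart_eq h5, betaPart_eq h5, alphaPart_eq h5', betaPart_eq h5', h1, h2]
    refine QuaternionAlgebra.ext ?_ ?_ ?_ ?_ <;> apply Complex.ext <;> simp [conjExt]
  · rw [h5 v hv, rhoExt_eq]
    simp only [reExt, imExt, stem, alphaPart_eq h5, betaPart_eq h5]
    rfl

/-- The value `F (x + ι y)` is determined by `f (x + v y) = ρ_v (F (x + ι y))`. -/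
theorem stem_unique {f : ℍ → ℍ} {z : ℂ} {w : Quaternion ℂ}
    (h : ∀ v ∈ imagUnits, f (rho v z) = rhoExt v w) : w = stem f z := by
  simp only [rhoExt_eq] at h
  simp only [stem, alphaPart_eq h, betaPart_eq h]
  rfl

/-- `Φ (z₀, z₁, z₂, z₃) = z₀² + z₁² + z₂² + z₃²`. -/
def Phi (w : Quaternion ℂ) : ℂ := w.re ^ 2 + w.imI ^ 2 + w.imJ ^ 2 + w.imK ^ 2

/-! ### Multiplicities of zeros -/

/-- The `⋆`-product: if `f (x + v y) = α + v β` and `g (x + v y) = γ + v δ`, then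
`(f ⋆ g) (x + v y) = (α γ - β δ) + v (α δ + β γ)` (see `starMul_spec`). -/
def starMul (f g : ℍ → ℍ) (q : ℍ) : ℍ :=
  let z : ℂ := ⟨q.re, ‖q.im‖⟩
  (alphaPart f z * alphaPart g z - betaPart f z * betaPart g z) +
    (‖q.im‖⁻¹ • q.im) * (alphaPart f z * betaPart g z + betaPart f z * alphaPart g z)

theorem rho_of_im_pos {v : ℍ} (hv : v ∈ imagUnits) {z : ℂ} (hz : 0 < z.im) :
    (rho v z).re = z.re ∧ ‖(rho v z).im‖ = z.im ∧ ‖(rho v z).im‖⁻¹ • (rho v z).im = v := by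
  have hv' : v * v = -1 := by simpa [imagUnits, pow_two] using hv
  have hre : v.re = 0 := by
    have h0 := congrArg QuaternionAlgebra.re hv'
    have h1 := congrArg QuaternionAlgebra.imI hv'
    have h2 := congrArg QuaternionAlgebra.imJ hv'
    have h3 := congrArg QuaternionAlgebra.imK hv'
    simp at h0 h1 h2 h3
    by_contra hne
    have e1 : v.imI = 0 := by
      have : v.re * v.imI = 0 := by linarith
      simpa [hne] using this
    have e2 : v.imJ = 0 := by
      have : v.re * v.imJ = 0 := by linarith
      simpa [hne] using this
    have e3 : v.imK = 0 := by
      have : v.re * v.imK = 0 := by linarith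
      simpa [hne] using this
    rw [e1, e2, e3] at h0
    nlinarith [sq_nonneg v.re]
  have hnorm : ‖v‖ = 1 := by
    have : ‖v‖ * ‖v‖ = 1 := by rw [← norm_mul, hv', norm_neg, norm_one]
    nlinarith [norm_nonneg v]
  have him : (rho v z).im = z.im • v := by
    ext <;> simp [rho, hre, mul_comm]
  have hn : ‖(rho v z).im‖ = z.im := by
    rw [him, norm_smul, hnorm, mul_one, Real.norm_eq_abs, abs_of_pos hz]
  refine ⟨by simp [rho, hre], hn, ?_⟩
  rw [hn, him, smul_smul, inv_mul_cancel₀ hz.ne', one_smul]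

theorem eq_zero_of_eq_neg {b : ℍ} (h : b = -b) : b = 0 := by
  have h2 : (2 : ℝ) • b = 0 := by
    rw [two_smul]
    nth_rewrite 2 [h]
    rw [add_neg_cancel]
  exact (smul_eq_zero.mp h2).resolve_left two_ne_zero

theorem starMul_spec {D : Set ℂ} (hD : ∀ z ∈ D, conj z ∈ D) {f g : ℍ → ℍ} {α β γ δ : ℂ → ℍ}
    (hβ : ∀ z ∈ D, β (conj z) = -β z) (hδ : ∀ z ∈ D, δ (conj z) = -δ z)
    (hα : ∀ z ∈ D, α (conj z) = α z) (hγ : ∀ z ∈ D, γ (conj z) = γ z)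
    (hf : ∀ z ∈ D, ∀ v ∈ imagUnits, f (rho v z) = α z + v * β z)
    (hg : ∀ z ∈ D, ∀ v ∈ imagUnits, g (rho v z) = γ z + v * δ z)
    {z : ℂ} (hz : z ∈ D) {v : ℍ} (hv : v ∈ imagUnits) :
    starMul f g (rho v z) = (α z * γ z - β z * δ z) + v * (α z * δ z + β z * γ z) := by
  have key : ∀ z ∈ D, 0 < z.im → ∀ v ∈ imagUnits,
      starMul f g (rho v z) = (α z * γ z - β z * δ z) + v * (α z * δ z + β z * γ z) := by
    intro z hz hpos v hv
    obtain ⟨h1, h2, h3⟩ := rho_of_im_pos hv hpos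
    have hzz : (⟨(rho v z).re, ‖(rho v z).im‖⟩ : ℂ) = z := Complex.ext h1 h2
    simp only [starMul, hzz, h3, alphaPart_eq (hf z hz), betaPart_eq (hf z hz),
      alphaPart_eq (hg z hz), betaPart_eq (hg z hz)]
  rcases lt_trichotomy z.im 0 with h | h | h
  · have hv' : -v ∈ imagUnits := by simpa [imagUnits] using hv
    have := key _ (hD z hz) (by simpa using h) (-v) hv'
    have hr : rho (-v) (conj z) = rho v z := by simp [rho]
    rw [hr, hα z hz, hβ z hz, hγ z hz, hδ z hz] at this
    rw [this]
    noncomm_ring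
  · have hc : conj z = z := Complex.ext (by simp) (by simp [h])
    have hb : β z = 0 := by
      have := hβ z hz
      rw [hc] at this
      exact eq_zero_of_eq_neg this
    have hd : δ z = 0 := by
      have := hδ z hz
      rw [hc] at this
      exact eq_zero_of_eq_neg this
    have hr : rho v z = (z.re : ℍ) := by simp [rho, h]
    have hzz : (⟨z.re, 0⟩ : ℂ) = z := Complex.ext rfl h.symm
    have hi : ((z.re : ℍ)).im = 0 := by simp
    simp only [starMul, hr, hi, norm_zero, Quaternion.re_coe, hzz, alphaPart_eq (hf z hz),
      betaPart_eq (hf z hz), alphaPart_eq (hg z hz), betaPart_eq (hg z hz), hb, hd]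
    simp
  · exact key z hz h v hv

/-- `(q - p₁) ⋆ (q - p₂) ⋆ ⋯ ⋆ (q - pₙ) ⋆ g`. -/
def starLinearFactors (ps : List ℍ) (g : ℍ → ℍ) : ℍ → ℍ :=
  ps.foldr (fun p h => starMul (fun q => q - p) h) g

/-- The real polynomial `(q - x)² + y²` that vanishes on the sphere of `z = x + ι y`. -/
def sphereFactor (z : ℂ) (q : ℍ) : ℍ := (q - (z.re : ℍ)) ^ 2 + (z.im : ℍ) ^ 2

/-- On the sphere `S` of `z = x + ι y`, the slice-regular function `f` has spherical multiplicity
`m` and isolated multiplicity `n`: there are points `p₁, …, pₙ ∈ S` and a slice-regular `g`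
without zeros on `S` such that
`f = ((q - x)² + y²)^m (q - p₁) ⋆ ⋯ ⋆ (q - pₙ) ⋆ g`,
where no two consecutive `p`s are conjugate if `y ≠ 0`. If `y = 0`, there is no spherical
factor: all the `p`s are `x`, and `f = (q - x)^n g` with `g x ≠ 0`. -/
def HasMultiplicities (D : Set ℂ) (f : ℍ → ℍ) (z : ℂ) (m n : ℕ) : Prop :=
  ∃ (ps : List ℍ) (g : ℍ → ℍ),
    ps.length = n ∧ (∀ p ∈ ps, p ∈ sphereOf z) ∧
    (z.im ≠ 0 → ps.IsChain (fun a b => b ≠ star a)) ∧ (z.im = 0 → m = 0) ∧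
    IsSliceRegularOn D g ∧ (∀ q ∈ sphereOf z, g q ≠ 0) ∧
    ∀ q ∈ circularization D, f q = sphereFactor z q ^ m * starLinearFactors ps g q

/-- The spherical multiplicity of `f` on the sphere of `z`. -/
def sphericalMultiplicity (D : Set ℂ) (f : ℍ → ℍ) (z : ℂ) : ℕ :=
  sSup {m | ∃ n, HasMultiplicities D f z m n}

/-- The isolated multiplicity of `f` on the sphere of `z`. -/
def isolatedMultiplicity (D : Set ℂ) (f : ℍ → ℍ) (z : ℂ) : ℕ :=
  sSup {n | ∃ m, HasMultiplicities D f z m n}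

/-- The spheres over `V` (each one represented by its point `z = x + ι y` with `y ≥ 0`) on which
`f` has a zero. -/
def zeroSpheres (f : ℍ → ℍ) (V : Set ℂ) : Set ℂ :=
  {z | z ∈ V ∧ 0 ≤ z.im ∧ ∃ q ∈ sphereOf z, f q = 0}

/-- Number of isolated (real or non-real) zeros over `V`, with multiplicities. -/
def isolatedZeroCount (D : Set ℂ) (f : ℍ → ℍ) (V : Set ℂ) : ℕ :=
  ∑ᶠ z ∈ zeroSpheres f V, isolatedMultiplicity D f z

/-- Number of spherical zeros over `V`, with multiplicities. -/
def sphericalZeroCount (D : Set ℂ) (f : ℍ → ℍ) (V : Set ℂ) : ℕ :=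
  ∑ᶠ z ∈ zeroSpheres f V, sphericalMultiplicity D f z

/-! ### Integration along the boundary -/

/-- A closed rectifiable curve, with a Lipschitz parametrisation on `[0, 1]`. -/
def IsClosedRectifiable (γ : ℝ → ℂ) : Prop :=
  (∃ K, LipschitzOnWith K γ (Set.Icc 0 1)) ∧ γ 0 = γ 1

/-- `∫_Γ g(z) dz` for a cycle `Γ`, i.e. a finite family of closed curves. -/
def cycleIntegral {N : ℕ} (Γ : Fin N → ℝ → ℂ) (g : ℂ → ℂ) : ℂ :=
  ∑ j, ∫ t in (0 : ℝ)..1, g (Γ j t) * deriv (Γ j) t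

/-- The winding number of a cycle around a point off it. -/
def windingNumber {N : ℕ} (Γ : Fin N → ℝ → ℂ) (a : ℂ) : ℂ :=
  (2 * Real.pi * Complex.I)⁻¹ * cycleIntegral Γ (fun z => (z - a)⁻¹)

/-- The cycle `Γ` is the (rectifiable) boundary of the open set `V` with its positive orientation:
it runs exactly through the boundary points of `V`, and it winds once around each point
of `V` and zero times around each exterior point. -/
structure IsOrientedBoundary {N : ℕ} (Γ : Fin N → ℝ → ℂ) (V : Set ℂ) : Prop where
  closed : ∀ j, IsClosedRectifiable (Γ j)
  range_eq : ⋃ j, Γ j '' Set.Icc 0 1 = frontier V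
  inside : ∀ a ∈ V, windingNumber Γ a = 1
  outside : ∀ a ∉ closure V, windingNumber Γ a = 0

end SliceRegular

end

/-!
The proof reduces the count of zeros of the slice-regular function `f` to the argument principle for
the holomorphic function `Φ ∘ F`, where `F : D → ℍ ⊗ ℂ` is the map inducing `f`.

*Algebra.* `ℍ ⊗ ℂ` is the algebra `Quaternion ℂ`, and `Φ` is its multiplicative norm form
(`Phi_mul`). The `⋆`-product of functions is the pointwise product of the inducing maps
(`Represents.starMul`), and `f` has a zero on the sphere of `z` exactly when `Φ (F z) = 0`
(`exists_rhoExt_eq_zero_iff`). A linear factor `q - p` with `p` on the sphere of `z₀ = x + ι y` and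
the sphere factor itself contribute `(z - x)² + y²` and its square to `Φ ∘ F`.

*Multiplicities.* If `F` vanishes at a non-real `z₀`, then `(z - x)² + y²` divides it; if only
`Φ ∘ F` does, then a linear factor splits off on the left (`IsStem.exists_eq_linFactor_mul`). The
order of `Φ ∘ F` at `z₀` drops each time, which gives existence. The spherical multiplicity is
the order of vanishing of `F`, since a product of linear factors without consecutive conjugate
points does not vanish at `z₀` (`linProd_mul_ne_zero`), and `2 m + n` is the order of `Φ ∘ F`
both at `z₀` and at its conjugate; at a real point the order is `2 n`. Hence the sum of the
orders of the zeros of `Φ ∘ F` is `2 k + 4 m`.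

*Argument principle.* The logarithmic derivative of `Φ ∘ F` is the sum of the polar parts at the
zeros in `V` and of a function holomorphic near the closure of `V`. The integral of the latter
vanishes by the homology form of Cauchy's theorem (`cycleIntegral_eq_zero`): for a cutoff `u` of a
holomorphic function `h`, the Cauchy-Pompeiu formula expresses `h` on the cycle as an integral of
kernels `1 / (ζ - z)` with `ζ` outside the closure of `V`, around which the cycle does not wind.
-/

noncomputable section

namespace SliceRegular

open MeasureTheory Set Filter Topology

/-! ### The Cauchy-Pompeiu formula -/

/-- The Wirtinger operator `∂u/∂z̄ = (∂u/∂x + i ∂u/∂y) / 2`. -/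
def dbar (u : ℂ → ℂ) (z : ℂ) : ℂ :=
  (1 / 2) * (fderiv ℝ u z 1 + Complex.I * fderiv ℝ u z Complex.I)

theorem continuous_dbar {u : ℂ → ℂ} (hu : ContDiff ℝ 1 u) : Continuous (dbar u) := by
  have h := hu.continuous_fderiv one_ne_zero
  unfold dbar
  fun_prop

theorem dbar_eq_zero_of_differentiableAt {u : ℂ → ℂ} {z : ℂ} (hu : DifferentiableAt ℂ u z) :
    dbar u z = 0 := by
  rw [dbar, (differentiableAt_complex_iff_differentiableAt_real.1 hu).2, smul_eq_mul, ← mul_assoc,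
    Complex.I_mul_I]
  ring

theorem dbar_congr {u v : ℂ → ℂ} {z : ℂ} (h : u =ᶠ[𝓝 z] v) :
    dbar u z = dbar v z := by
  rw [dbar, dbar, h.fderiv_eq]

theorem dbar_comp_add_right (u : ℂ → ℂ) (w z : ℂ) :
    dbar (fun z => u (z + w)) z = dbar u (z + w) := by
  rw [dbar, dbar, fderiv_comp_add_right]

/-- In polar coordinates, `∂/∂z̄ = e^{iθ} (∂/∂r + (i/r) ∂/∂θ) / 2`. -/
theorem dbar_polar (u : ℂ → ℂ) {r θ : ℝ} (hr : 0 < r) :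
    r • (dbar u (r * Complex.exp (θ * Complex.I)) / (r * Complex.exp (θ * Complex.I))) =
      (1 / 2) * (fderiv ℝ u (r * Complex.exp (θ * Complex.I)) (Complex.exp (θ * Complex.I)) +
        Complex.I * fderiv ℝ u (r * Complex.exp (θ * Complex.I))
          (Complex.I * Complex.exp (θ * Complex.I))) := by
  have hr' : (r : ℂ) ≠ 0 := by exact_mod_cast hr.ne'
  have he := Complex.exp_ne_zero (θ * Complex.I)
  rw [dbar]
  set L := fderiv ℝ u (r * Complex.exp (θ * Complex.I))
  have h1 : Complex.exp (θ * Complex.I) = Real.cos θ • (1 : ℂ) + Real.sin θ • Complex.I := by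
    rw [Complex.exp_mul_I]; simp
  have h2 : Complex.I * Complex.exp (θ * Complex.I)
      = Real.cos θ • Complex.I - Real.sin θ • (1 : ℂ) := by
    rw [Complex.exp_mul_I]
    simp only [Complex.real_smul, Complex.ofReal_cos, Complex.ofReal_sin]
    linear_combination (Complex.sin θ) * Complex.I_sq
  have h3 : (Complex.exp (θ * Complex.I))⁻¹ = Real.cos θ - Real.sin θ * Complex.I := by
    rw [← Complex.exp_neg, ← neg_mul, ← Complex.ofReal_neg, Complex.exp_mul_I]
    simp [sub_eq_add_neg]
  have h4 : L (Complex.exp (θ * Complex.I)) = Real.cos θ * L 1 + Real.sin θ * L Complex.I := by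
    rw [h1, map_add, map_smul, map_smul]; simp
  have h5 : L (Complex.I * Complex.exp (θ * Complex.I))
      = Real.cos θ * L Complex.I - Real.sin θ * L 1 := by
    rw [h2, map_sub, map_smul, map_smul]; simp
  rw [h4, h5, Complex.real_smul, mul_div_assoc', mul_comm (r : ℂ) (Complex.exp _), mul_comm (r : ℂ),
    mul_div_mul_right _ _ hr', div_eq_mul_inv, h3]
  linear_combination (-(1 / 2) * Real.sin θ * L Complex.I) * Complex.I_sq

/-- The Cauchy-Pompeiu formula at the origin, by integration in polar coordinates. -/
theorem integral_dbar_div_self {u : ℂ → ℂ} (hu : ContDiff ℝ 1 u) (hc : HasCompactSupport u) :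
    ∫ z, dbar u z / z = -Real.pi * u 0 := by
  have hd := hu.continuous_fderiv one_ne_zero
  obtain ⟨R, hR0, hR⟩ : ∃ R : ℝ, 0 < R ∧ tsupport u ⊆ Metric.ball 0 R := by
    obtain ⟨R, hR0, hR⟩ := hc.isCompact.isBounded.subset_ball_lt 0 0
    exact ⟨R, hR0, hR⟩
  have hzero : ∀ r θ : ℝ, R ≤ r → (r * Complex.exp (θ * Complex.I)) ∉ tsupport u := by
    intro r θ hr hm
    have := hR hm
    rw [mem_ball_zero_iff, norm_mul, Complex.norm_exp_ofReal_mul_I, mul_one, Complex.norm_real,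
      Real.norm_eq_abs] at this
    exact absurd (le_abs_self r) (by linarith)
  have hderiv0 : ∀ z, z ∉ tsupport u → fderiv ℝ u z = 0 := fun z hz =>
    image_eq_zero_of_notMem_tsupport fun h => hz (tsupport_fderiv_subset ℝ h)
  set A : ℝ × ℝ → ℂ := fun p => fderiv ℝ u (p.1 * Complex.exp (p.2 * Complex.I))
    (Complex.exp (p.2 * Complex.I)) with hA
  set B : ℝ × ℝ → ℂ := fun p => fderiv ℝ u (p.1 * Complex.exp (p.2 * Complex.I))
    (Complex.I * Complex.exp (p.2 * Complex.I)) with hB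
  have hAc : Continuous A := by
    simp only [hA]; fun_prop
  have hBc : Continuous B := by
    simp only [hB]; fun_prop
  have hint : ∀ C : ℝ × ℝ → ℂ, Continuous C → (∀ p, R ≤ p.1 → C p = 0) →
      IntegrableOn C (Ioi 0 ×ˢ Ioo (-Real.pi) Real.pi) (volume.prod volume) := by
    intro C hC h0
    have h1 : IntegrableOn C (Icc 0 R ×ˢ Icc (-Real.pi) Real.pi) (volume.prod volume) :=
      hC.continuousOn.integrableOn_compact (isCompact_Icc.prod isCompact_Icc)
    refine h1.of_forall_sdiff_eq_zero (measurableSet_Ioi.prod measurableSet_Ioo) ?_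
    rintro ⟨r, θ⟩ ⟨⟨h2, h3⟩, h4⟩
    apply h0
    by_contra h5
    exact h4 ⟨⟨le_of_lt h2, le_of_not_ge h5⟩, ⟨h3.1.le, h3.2.le⟩⟩
  have hAi := hint A hAc fun p hp => by
    simp [hA, hderiv0 _ (hzero p.1 p.2 hp)]
  have hBi := hint B hBc fun p hp => by
    simp [hB, hderiv0 _ (hzero p.1 p.2 hp)]
  -- The radial derivative is integrated in `r` first.
  have hAint : ∀ θ : ℝ, ∫ r in Ioi (0 : ℝ), A (r, θ) = -u 0 := by
    intro θ
    have hg : ∀ r : ℝ, HasDerivAt (fun r : ℝ => u (r * Complex.exp (θ * Complex.I)))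
        (A (r, θ)) r := by
      intro r
      have h1 : HasDerivAt (fun r : ℝ => (r : ℂ) * Complex.exp (θ * Complex.I))
          (Complex.exp (θ * Complex.I)) r := by
        simpa using (Complex.ofRealCLM.hasDerivAt (x := r)).mul_const (Complex.exp (θ * Complex.I))
      exact ((hu.differentiable one_ne_zero _).hasFDerivAt).comp_hasDerivAt r h1
    have hi : IntegrableOn (fun r => A (r, θ)) (Ioi 0) := by
      have h1 : IntegrableOn (fun r => A (r, θ)) (Icc 0 R) :=
        (by fun_prop : Continuous fun r => A (r, θ)).continuousOn.integrableOn_compact isCompact_Icc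
      refine h1.of_forall_sdiff_eq_zero measurableSet_Ioi ?_
      rintro r ⟨h2, h4⟩
      have : R ≤ r := by
        by_contra h5
        exact h4 ⟨le_of_lt h2, le_of_not_ge h5⟩
      simp [hA, hderiv0 _ (hzero r θ this)]
    have ht : Tendsto (fun r : ℝ => u (r * Complex.exp (θ * Complex.I))) atTop (𝓝 0) := by
      refine tendsto_const_nhds.congr' ?_
      filter_upwards [eventually_ge_atTop R] with r hr
      exact (image_eq_zero_of_notMem_tsupport (hzero r θ hr)).symm
    rw [integral_Ioi_of_hasDerivAt_of_tendsto' (fun r _ => hg r) hi ht]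
    simp
  -- The angular derivative is integrated in `θ` first: its primitive is periodic.
  have hBint : ∀ r : ℝ, 0 < r → ∫ θ in Ioo (-Real.pi) Real.pi, B (r, θ) = 0 := by
    intro r hr
    have hg : ∀ θ : ℝ, HasDerivAt (fun θ : ℝ => u (r * Complex.exp (θ * Complex.I)))
        (r • B (r, θ)) θ := by
      intro θ
      have h1 : HasDerivAt (fun θ : ℝ => (r : ℂ) * Complex.exp (θ * Complex.I))
          (r • (Complex.I * Complex.exp (θ * Complex.I))) θ := by
        have := (((Complex.ofRealCLM.hasDerivAt (x := θ)).mul_const Complex.I).cexp).const_mul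
          (r : ℂ)
        exact this.congr_deriv (by simp [mul_comm])
      have h2 := ((hu.differentiable one_ne_zero _).hasFDerivAt).comp_hasDerivAt θ h1
      rw [map_smul] at h2
      exact h2
    have h3 : ∫ θ in (-Real.pi)..Real.pi, r • B (r, θ) = 0 := by
      rw [intervalIntegral.integral_eq_sub_of_hasDerivAt (fun θ _ => hg θ)
        ((by fun_prop : Continuous fun θ => r • B (r, θ)).intervalIntegrable _ _)]
      simp [Complex.exp_neg]
    rw [intervalIntegral.integral_smul, smul_eq_zero] at h3
    rw [← integral_Ioc_eq_integral_Ioo,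
      ← intervalIntegral.integral_of_le (by linarith [Real.pi_pos])]
    exact h3.resolve_left hr.ne'
  rw [← Complex.integral_comp_polarCoord_symm]
  have hcongr : ∫ p in polarCoord.target,
      p.1 • (dbar u (Complex.polarCoord.symm p) / Complex.polarCoord.symm p) =
      ∫ p in Ioi (0 : ℝ) ×ˢ Ioo (-Real.pi) Real.pi, ((1 / 2) * (A p + Complex.I * B p))
        ∂(volume.prod volume) := by
    rw [polarCoord_target]
    refine setIntegral_congr_fun (measurableSet_Ioi.prod measurableSet_Ioo) ?_
    rintro ⟨r, θ⟩ ⟨h1, -⟩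
    have : Complex.polarCoord.symm (r, θ) = r * Complex.exp (θ * Complex.I) := by
      rw [Complex.polarCoord_symm_apply, Complex.exp_mul_I]
      simp
    simp only [this]
    exact dbar_polar u h1
  rw [hcongr, integral_const_mul, integral_add hAi (hBi.const_mul _), integral_const_mul,
    setIntegral_prod _ hBi, setIntegral_congr_fun measurableSet_Ioi (fun r hr => hBint r hr),
    ← setIntegral_prod_swap, setIntegral_prod (fun p => A p.swap) hAi.swap]
  simp only [Prod.swap_prod_mk, hAint]
  simp
  have : (Real.pi + Real.pi : ℝ) = 2 * Real.pi := by ring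
  rw [max_eq_left (by positivity)]
  push_cast
  ring

/-- The Cauchy-Pompeiu formula for a compactly supported function. -/
theorem integral_dbar_div_sub {u : ℂ → ℂ} (hu : ContDiff ℝ 1 u) (hc : HasCompactSupport u) (w : ℂ) :
    ∫ z, dbar u z / (z - w) = -Real.pi * u w := by
  have h1 : ContDiff ℝ 1 (fun z => u (z + w)) := hu.comp (contDiff_id.add contDiff_const)
  have h2 : HasCompactSupport (fun z => u (z + w)) :=
    hc.comp_homeomorph (Homeomorph.addRight w)
  have := integral_dbar_div_self h1 h2
  rw [zero_add] at this
  rw [← this, ← integral_add_right_eq_self _ w]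
  simp [dbar_comp_add_right]

/-! ### Integrals along cycles -/

theorem IsClosedRectifiable.continuousOn {γ : ℝ → ℂ} (hγ : IsClosedRectifiable γ) :
    ContinuousOn γ (Icc 0 1) := by
  obtain ⟨⟨K, hK⟩, -⟩ := hγ
  exact hK.continuousOn

theorem IsClosedRectifiable.exists_norm_deriv_le {γ : ℝ → ℂ} (hγ : IsClosedRectifiable γ) :
    ∃ C, 0 ≤ C ∧ ∀ t ∈ Ioo (0 : ℝ) 1, ‖deriv γ t‖ ≤ C := by
  obtain ⟨⟨K, hK⟩, -⟩ := hγ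
  exact ⟨K, K.2, fun t ht => norm_deriv_le_of_lipschitzOn (Icc_mem_nhds ht.1 ht.2) hK⟩

theorem intervalIntegral_eq_setIntegral_Ioo (g : ℝ → ℂ) :
    ∫ t in (0 : ℝ)..1, g t = ∫ t in Ioo (0 : ℝ) 1, g t := by
  rw [intervalIntegral.integral_of_le zero_le_one, integral_Ioc_eq_integral_Ioo]

theorem IsClosedRectifiable.intervalIntegrable {γ : ℝ → ℂ} (hγ : IsClosedRectifiable γ)
    {g : ℂ → ℂ} (hg : ContinuousOn g (γ '' Icc 0 1)) :
    IntervalIntegrable (fun t => g (γ t) * deriv γ t) volume 0 1 := by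
  obtain ⟨C, -, hC⟩ := hγ.exists_norm_deriv_le
  rw [intervalIntegrable_iff_integrableOn_Ioo_of_le zero_le_one]
  have hgc : ContinuousOn (fun t => g (γ t)) (Icc 0 1) :=
    hg.comp hγ.continuousOn (mapsTo_image _ _)
  have h1 : IntegrableOn (fun t => g (γ t)) (Ioo 0 1) :=
    (hgc.integrableOn_compact isCompact_Icc).mono_set Ioo_subset_Icc_self
  refine h1.mul_bdd (c := C) (measurable_deriv γ).aestronglyMeasurable ?_
  exact (ae_restrict_iff' measurableSet_Ioo).2 (Eventually.of_forall hC)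

section cycle

variable {N : ℕ} {Γ : Fin N → ℝ → ℂ}

theorem cycleIntegral_congr {g h : ℂ → ℂ} (H : ∀ j, ∀ z ∈ Γ j '' Icc 0 1, g z = h z) :
    cycleIntegral Γ g = cycleIntegral Γ h := by
  refine Finset.sum_congr rfl fun j _ => intervalIntegral.integral_congr fun t ht => ?_
  rw [uIcc_of_le zero_le_one] at ht
  simp only [H j _ (mem_image_of_mem _ ht)]

theorem cycleIntegral_const_mul (c : ℂ) (g : ℂ → ℂ) :
    cycleIntegral Γ (fun z => c * g z) = c * cycleIntegral Γ g := by
  simp only [cycleIntegral, Finset.mul_sum, mul_assoc, intervalIntegral.integral_const_mul]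

theorem cycleIntegral_add (hΓ : ∀ j, IsClosedRectifiable (Γ j)) {g h : ℂ → ℂ}
    (hg : ∀ j, ContinuousOn g (Γ j '' Icc 0 1)) (hh : ∀ j, ContinuousOn h (Γ j '' Icc 0 1)) :
    cycleIntegral Γ (fun z => g z + h z) = cycleIntegral Γ g + cycleIntegral Γ h := by
  simp only [cycleIntegral, ← Finset.sum_add_distrib, add_mul]
  exact Finset.sum_congr rfl fun j _ => intervalIntegral.integral_add
    ((hΓ j).intervalIntegrable (hg j)) ((hΓ j).intervalIntegrable (hh j))

theorem cycleIntegral_finset_sum (hΓ : ∀ j, IsClosedRectifiable (Γ j)) {ι : Type*} (s : Finset ι)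
    {g : ι → ℂ → ℂ} (hg : ∀ i ∈ s, ∀ j, ContinuousOn (g i) (Γ j '' Icc 0 1)) :
    cycleIntegral Γ (fun z => ∑ i ∈ s, g i z) = ∑ i ∈ s, cycleIntegral Γ (g i) := by
  simp only [cycleIntegral, Finset.sum_mul]
  rw [Finset.sum_comm]
  exact Finset.sum_congr rfl fun j _ => intervalIntegral.integral_finsetSum
    fun i hi => (hΓ j).intervalIntegrable (hg i hi j)

theorem cycleIntegral_sub_inv_eq (a : ℂ) :
    cycleIntegral Γ (fun z => (z - a)⁻¹) = 2 * Real.pi * Complex.I * windingNumber Γ a := by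
  rw [windingNumber, ← mul_assoc, mul_inv_cancel₀ Complex.two_pi_I_ne_zero, one_mul]

/-- Cutting off a holomorphic function near a compact set. -/
theorem exists_contDiff_cutoff {K O : Set ℂ} (hK : IsCompact K) (hO : IsOpen O) (hKO : K ⊆ O)
    {h : ℂ → ℂ} (hh : DifferentiableOn ℂ h O) :
    ∃ u : ℂ → ℂ, ContDiff ℝ 1 u ∧ HasCompactSupport u ∧
      ∃ W, IsOpen W ∧ K ⊆ W ∧ (∀ z ∈ W, dbar u z = 0) ∧ ∀ z ∈ K, u z = h z := by
  obtain ⟨L, hL, hKL, hLO⟩ := exists_compact_between hK hO hKO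
  obtain ⟨χ, h1, h0, -⟩ := exists_contMDiffMap_one_nhds_of_subset_interior
    (modelWithCornersSelf ℝ ℂ) (n := 1) hK.isClosed hKL
  have hχ : ContDiff ℝ 1 χ := χ.contMDiff.contDiff
  obtain ⟨W, hW, hKW, hW1⟩ := eventually_nhdsSet_iff_exists.1 h1
  have hsupp : tsupport χ ⊆ L :=
    closure_minimal (fun x hx => by_contra fun hxL => hx (h0 x hxL)) hL.isClosed
  have hev : ∀ z ∈ W, (fun z => (χ z : ℂ) * h z) =ᶠ[𝓝 z] h := by
    intro z hz
    filter_upwards [hW.mem_nhds hz] with x hx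
    simp [hW1 x hx]
  refine ⟨fun z => (χ z : ℂ) * h z, ?_, ?_, W ∩ O, hW.inter hO,
    subset_inter hKW hKO, ?_, fun z hz => by simp [hW1 z (hKW hz)]⟩
  · rw [contDiff_iff_contDiffAt]
    intro z
    by_cases hz : z ∈ O
    · have : ContDiffAt ℝ 1 h z :=
        ((hh.analyticOnNhd hO z hz).contDiffAt (n := 1)).restrict_scalars ℝ
      exact (Complex.ofRealCLM.contDiff.comp hχ).contDiffAt.mul this
    · have hz' : z ∉ tsupport χ := fun hm => hz (hLO (hsupp hm))
      refine (contDiffAt_const (c := (0 : ℂ))).congr_of_eventuallyEq ?_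
      filter_upwards [(isClosed_tsupport χ).isOpen_compl.mem_nhds hz'] with x hx
      simp [image_eq_zero_of_notMem_tsupport hx]
  · refine HasCompactSupport.intro hL fun x hx => ?_
    simp [h0 x hx]
  · rintro z ⟨hz, hzO⟩
    rw [dbar_congr (hev z hz)]
    exact dbar_eq_zero_of_differentiableAt (hh.differentiableAt (hO.mem_nhds hzO))

/-- Homology form of Cauchy's theorem. If `u` is a cutoff of `h`, Cauchy-Pompeiu writes `h` on
the cycle as a superposition of the kernels `1 / (ζ - z)` with `ζ ∉ K`, and the integral of each of
them along the cycle is a winding number around a point off `K`. -/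
theorem cycleIntegral_eq_zero {K O : Set ℂ} (hK : IsCompact K) (hO : IsOpen O) (hKO : K ⊆ O)
    (hΓ : ∀ j, IsClosedRectifiable (Γ j)) (hΓK : ∀ j, Γ j '' Icc 0 1 ⊆ K)
    (hw : ∀ a ∉ K, windingNumber Γ a = 0) {h : ℂ → ℂ} (hh : DifferentiableOn ℂ h O) :
    cycleIntegral Γ h = 0 := by
  obtain ⟨u, hu, huc, W, hW, hKW, hW0, huh⟩ := exists_contDiff_cutoff hK hO hKO hh
  set S : Set ℂ := tsupport u \ W with hS
  have hSc : IsCompact S := huc.isCompact.diff hW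
  have hSK : ∀ z ∈ S, z ∉ K := fun z hz hzK => hz.2 (hKW hzK)
  have hS0 : ∀ z ∉ S, dbar u z = 0 := by
    intro z hz
    by_cases hzW : z ∈ W
    · exact hW0 z hzW
    · have hz' : z ∉ tsupport u := fun hm => hz ⟨hm, hzW⟩
      have : fderiv ℝ u z = 0 :=
        image_eq_zero_of_notMem_tsupport fun h => hz' (tsupport_fderiv_subset ℝ h)
      simp [dbar, this]
  have hdc := continuous_dbar hu
  obtain ⟨M, hM⟩ := hSc.exists_bound_of_continuousOn hdc.continuousOn
  obtain ⟨δ, hδ, hδS⟩ : ∃ δ : ℝ, 0 < δ ∧ ∀ z ∈ S, ∀ w ∈ K, δ ≤ ‖z - w‖ := by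
    have hdisj : Disjoint S K := disjoint_left.2 hSK
    obtain ⟨r, hr, hrS⟩ := hdisj.exists_thickenings hSc hK.isClosed
    refine ⟨r, hr, fun z hz w hwK => ?_⟩
    by_contra hlt
    push Not at hlt
    refine disjoint_left.1 hrS (Metric.self_subset_thickening hr S hz) ?_
    exact Metric.mem_thickening_iff.2 ⟨w, hwK, by rwa [dist_eq_norm]⟩
  have hint : ∀ j, Integrable (Function.uncurry fun (t : ℝ) (z : ℂ) =>
      dbar u z / (z - Γ j t) * deriv (Γ j) t)
      ((volume.restrict (Ioo (0 : ℝ) 1)).prod (volume.restrict S)) := by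
    intro j
    obtain ⟨C, hC0, hC⟩ := (hΓ j).exists_norm_deriv_le
    have hm1 : AEMeasurable (Γ j) (volume.restrict (Ioo (0 : ℝ) 1)) :=
      ((hΓ j).continuousOn.mono Ioo_subset_Icc_self).aemeasurable measurableSet_Ioo
    have hm : AEMeasurable (Function.uncurry fun (t : ℝ) (z : ℂ) =>
        dbar u z / (z - Γ j t) * deriv (Γ j) t)
        ((volume.restrict (Ioo (0 : ℝ) 1)).prod (volume.restrict S)) := by
      have h1 : AEMeasurable (fun p : ℝ × ℂ => Γ j p.1)
        ((volume.restrict (Ioo (0 : ℝ) 1)).prod (volume.restrict S)) := hm1.comp_fst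
      exact ((hdc.measurable.comp measurable_snd).aemeasurable.div
        (measurable_snd.aemeasurable.sub h1)).mul
        ((measurable_deriv (Γ j)).comp measurable_fst).aemeasurable
    have : IsFiniteMeasure (volume.restrict S) := ⟨by simpa using hSc.measure_lt_top⟩
    refine Integrable.of_bound hm.aestronglyMeasurable (M / δ * C) ?_
    rw [Measure.prod_restrict, ae_restrict_iff' (measurableSet_Ioo.prod hSc.measurableSet)]
    refine Eventually.of_forall ?_
    rintro ⟨t, z⟩ ⟨ht, hz⟩
    simp only [Function.uncurry_apply_pair, norm_mul, norm_div]
    have hb := hδS z hz (Γ j t) (hΓK j (mem_image_of_mem _ (Ioo_subset_Icc_self ht)))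
    have hM0 : 0 ≤ M := (norm_nonneg _).trans (hM z hz)
    have h1 := hM z hz
    have h2 := hC t ht
    gcongr
  have hrepr : ∀ w ∈ K, h w = -(Real.pi : ℂ)⁻¹ * ∫ z in S, dbar u z / (z - w) := by
    intro w hwK
    have hpi : (Real.pi : ℂ) ≠ 0 := by exact_mod_cast Real.pi_ne_zero
    rw [setIntegral_eq_integral_of_forall_compl_eq_zero (fun z hz => by rw [hS0 z hz, zero_div]),
      integral_dbar_div_sub hu huc, huh w hwK]
    field_simp
  rw [cycleIntegral_congr (h := fun w => -(Real.pi : ℂ)⁻¹ * ∫ z in S, dbar u z / (z - w))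
    (fun j z hz => hrepr z (hΓK j hz)), cycleIntegral_const_mul]
  have hswap : ∀ j, ∫ t in (0 : ℝ)..1, (∫ z in S, dbar u z / (z - Γ j t)) * deriv (Γ j) t =
      ∫ z in S, ∫ t in Ioo (0 : ℝ) 1, dbar u z / (z - Γ j t) * deriv (Γ j) t := by
    intro j
    rw [intervalIntegral_eq_setIntegral_Ioo, ← integral_integral_swap (hint j)]
    simp only [integral_mul_const]
  rw [cycleIntegral]
  simp only [hswap]
  have hsum := integral_finsetSum Finset.univ fun j _ => (hint j).integral_prod_right
  simp only [Function.uncurry_apply_pair] at hsum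
  rw [← hsum]
  have hz : ∀ z ∈ S, ∑ j, ∫ t in Ioo (0 : ℝ) 1, dbar u z / (z - Γ j t) * deriv (Γ j) t = 0 := by
    intro z hz
    have h1 : cycleIntegral Γ (fun w => -dbar u z * (w - z)⁻¹) = 0 := by
      rw [cycleIntegral_const_mul, cycleIntegral_sub_inv_eq, hw z (hSK z hz)]
      simp
    rw [← h1, cycleIntegral]
    refine Finset.sum_congr rfl fun j _ => ?_
    rw [intervalIntegral_eq_setIntegral_Ioo]
    congr 1
    ext t
    rw [← neg_sub z, inv_neg]
    ring
  rw [setIntegral_congr_fun hSc.measurableSet hz]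
  simp

end cycle

/-! ### The argument principle -/

section argument

variable {N : ℕ} {Γ : Fin N → ℝ → ℂ} {D V : Set ℂ} {φ : ℂ → ℂ}

/-- An oriented boundary lies in a bounded set, and winding numbers tend to zero at infinity. -/
theorem IsOrientedBoundary.isBounded (hΓ : IsOrientedBoundary Γ V) : Bornology.IsBounded V := by
  choose C hC0 hC using fun j => (hΓ.closed j).exists_norm_deriv_le
  have hcpt : IsCompact (⋃ j, Γ j '' Icc 0 1) :=
    isCompact_iUnion fun j => isCompact_Icc.image_of_continuousOn (hΓ.closed j).continuousOn
  obtain ⟨R, hR⟩ := hcpt.isBounded.exists_norm_le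
  have hS0 : 0 ≤ ∑ j, C j := Finset.sum_nonneg fun j _ => hC0 j
  refine (Metric.isBounded_closedBall (x := (0 : ℂ)) (r := R + ∑ j, C j + 1)).subset ?_
  intro a ha
  by_contra hlt
  rw [mem_closedBall_zero_iff, not_le] at hlt
  have hd : 0 < ‖a‖ - R := by linarith
  have h1 : cycleIntegral Γ (fun z => (z - a)⁻¹) = 2 * Real.pi * Complex.I := by
    rw [cycleIntegral_sub_inv_eq, hΓ.inside a ha, mul_one]
  have h2 : ‖cycleIntegral Γ (fun z => (z - a)⁻¹)‖ ≤ ∑ j, (‖a‖ - R)⁻¹ * C j := by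
    refine norm_sum_le_of_le _ fun j _ => ?_
    rw [intervalIntegral_eq_setIntegral_Ioo]
    have := norm_setIntegral_le_of_norm_le_const (μ := volume) (s := Ioo (0 : ℝ) 1)
      (f := fun t => (Γ j t - a)⁻¹ * deriv (Γ j) t) (C := (‖a‖ - R)⁻¹ * C j) (by simp) ?_
    · simpa using this
    · intro t ht
      have h3 : ‖Γ j t‖ ≤ R :=
        hR _ (mem_iUnion_of_mem j (mem_image_of_mem _ (Ioo_subset_Icc_self ht)))
      have h4 : ‖a‖ - R ≤ ‖Γ j t - a‖ := by
        have := norm_sub_norm_le a (Γ j t)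
        rw [norm_sub_rev] at this
        linarith
      have h5 := hC j t ht
      have h6 := hC0 j
      rw [norm_mul, norm_inv]
      gcongr
  rw [← Finset.mul_sum, h1] at h2
  have h3 : ‖(2 * Real.pi * Complex.I : ℂ)‖ = 2 * Real.pi := by
    simp [abs_of_pos Real.pi_pos]
  have h4 : (‖a‖ - R)⁻¹ * ∑ j, C j ≤ 1 := by
    rw [inv_mul_le_iff₀ hd]
    linarith
  rw [h3] at h2
  linarith [Real.pi_gt_three]

/-- A holomorphic function without zeros on the boundary of a bounded open set vanishes to finite
order at its zeros inside: the set where it vanishes to infinite order is clopen in the plane. -/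
theorem analyticOrderAt_ne_top_of_ne_zero_on_frontier (hD : IsOpen D) (hV : IsOpen V)
    (hVb : Bornology.IsBounded V) (hVD : closure V ⊆ D) (hφ : DifferentiableOn ℂ φ D)
    (h0 : ∀ z ∈ frontier V, φ z ≠ 0) {a : ℂ} (ha : a ∈ V) : analyticOrderAt φ a ≠ ⊤ := by
  intro htop
  rw [analyticOrderAt_eq_top] at htop
  set P : Set ℂ := {z | z ∈ V ∧ ∀ᶠ w in 𝓝 z, φ w = 0} with hP
  have hopen : IsOpen P := hV.inter (isOpen_setOfPred_eventually_nhds)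
  have hclosed : IsClosed P := by
    refine isClosed_of_closure_subset fun z hz => ?_
    have hzV : z ∈ closure V := closure_mono (fun w hw => hw.1) hz
    have han := hφ.analyticOnNhd hD z (hVD hzV)
    rcases han.eventually_eq_zero_or_eventually_ne_zero with h | h
    · refine ⟨?_, h⟩
      by_contra hzn
      exact h0 z (by rw [hV.frontier_eq]; exact ⟨hzV, hzn⟩) h.self_of_nhds
    · rw [eventually_nhdsWithin_iff] at h
      obtain ⟨w, hw1, hw2⟩ := (mem_closure_iff_frequently.1 hz).and_eventually h |>.exists
      have : w = z := by
        by_contra hne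
        exact hw2 hne hw1.2.self_of_nhds
      exact this ▸ hw1
  have huniv : P = univ := IsClopen.eq_univ ⟨hclosed, hopen⟩ ⟨a, ha, htop⟩
  exact NormedSpace.unbounded_univ ℂ ℂ (hVb.subset (huniv ▸ fun z hz => hz.1))

theorem finite_zeros_of_ne_zero_on_frontier (hD : IsOpen D) (hV : IsOpen V)
    (hVb : Bornology.IsBounded V) (hVD : closure V ⊆ D) (hφ : DifferentiableOn ℂ φ D)
    (h0 : ∀ z ∈ frontier V, φ z ≠ 0) : {z | z ∈ V ∧ φ z = 0}.Finite := by
  by_contra hinf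
  obtain ⟨z, hzV, hacc⟩ := Set.Infinite.exists_accPt_of_subset_isCompact hinf hVb.isCompact_closure
    (fun w hw => subset_closure hw.1)
  have han := hφ.analyticOnNhd hD z (hVD hzV)
  have hfreq := accPt_iff_frequently_nhdsNE.1 hacc
  have hev : ∀ᶠ w in 𝓝 z, φ w = 0 :=
    han.frequently_zero_iff_eventually_zero.1 (hfreq.mono fun w hw => hw.2)
  by_cases hz : z ∈ V
  · exact analyticOrderAt_ne_top_of_ne_zero_on_frontier hD hV hVb hVD hφ h0 hz
      (analyticOrderAt_eq_top.2 hev)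
  · exact h0 z (by rw [hV.frontier_eq]; exact ⟨hzV, hz⟩) hev.self_of_nhds

/-- A zero of finite order is divided out globally. -/
theorem exists_eq_sub_pow_mul (hD : IsOpen D) (hφ : DifferentiableOn ℂ φ D) {a : ℂ} (ha : a ∈ D)
    (hord : analyticOrderAt φ a ≠ ⊤) :
    ∃ ψ : ℂ → ℂ, DifferentiableOn ℂ ψ D ∧ ψ a ≠ 0 ∧
      ∀ z, φ z = (z - a) ^ analyticOrderNatAt φ a * ψ z := by
  have han := hφ.analyticOnNhd hD a ha
  obtain ⟨g, hg, hga, hev⟩ := (han.analyticOrderAt_ne_top).1 hord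
  set n := analyticOrderNatAt φ a
  set ψ : ℂ → ℂ := Function.update (fun z => φ z / (z - a) ^ n) a (g a) with hψ
  have hne : ∀ z, z ≠ a → ψ z = φ z / (z - a) ^ n := fun z hz => by simp [hψ, hz]
  have hevψ : ψ =ᶠ[𝓝 a] g := by
    filter_upwards [hev] with z hz
    rcases eq_or_ne z a with rfl | hza
    · simp [hψ]
    · rw [hne z hza, hz, smul_eq_mul, mul_div_cancel_left₀ _ (pow_ne_zero _ (sub_ne_zero.2 hza))]
  refine ⟨ψ, fun z hz => ?_, by simpa [hψ] using hga, fun z => ?_⟩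
  · rcases eq_or_ne z a with rfl | hza
    · exact (hg.differentiableAt.congr_of_eventuallyEq hevψ).differentiableWithinAt
    · have h1 : DifferentiableAt ℂ (fun z => φ z / (z - a) ^ n) z :=
        (hφ.differentiableAt (hD.mem_nhds hz)).div (by fun_prop)
          (pow_ne_zero _ (sub_ne_zero.2 hza))
      refine (h1.congr_of_eventuallyEq ?_).differentiableWithinAt
      filter_upwards [isOpen_ne.mem_nhds hza] with w hw
      exact hne w hw
  · rcases eq_or_ne z a with rfl | hza
    · simpa [hψ] using hev.self_of_nhds
    · rw [hne z hza, mul_div_cancel₀ _ (pow_ne_zero _ (sub_ne_zero.2 hza))]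

theorem exists_eq_prod_sub_pow_mul (hD : IsOpen D) (hφ : DifferentiableOn ℂ φ D) (Z : Finset ℂ)
    (hZ : ∀ a ∈ Z, a ∈ D ∧ analyticOrderAt φ a ≠ ⊤) :
    ∃ ψ : ℂ → ℂ, DifferentiableOn ℂ ψ D ∧ (∀ a ∈ Z, ψ a ≠ 0) ∧
      ∀ z, φ z = (∏ a ∈ Z, (z - a) ^ analyticOrderNatAt φ a) * ψ z := by
  classical
  induction Z using Finset.induction_on with
  | empty => exact ⟨φ, hφ, by simp, by simp⟩
  | insert b Z hb ih =>
    obtain ⟨ψ, hψ, hψ0, hψeq⟩ := ih fun a ha => hZ a (Finset.mem_insert_of_mem ha)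
    obtain ⟨hbD, hbt⟩ := hZ b (Finset.mem_insert_self b Z)
    have hprod : AnalyticAt ℂ (fun z => ∏ a ∈ Z, (z - a) ^ analyticOrderNatAt φ a) b := by fun_prop
    have hprod0 : analyticOrderAt (fun z => ∏ a ∈ Z, (z - a) ^ analyticOrderNatAt φ a) b = 0 := by
      rw [hprod.analyticOrderAt_eq_zero, Finset.prod_ne_zero_iff]
      exact fun a ha => pow_ne_zero _ (sub_ne_zero.2 fun h => hb (h ▸ ha))
    have hord : analyticOrderAt φ b = analyticOrderAt ψ b := by
      have : φ = (fun z => ∏ a ∈ Z, (z - a) ^ analyticOrderNatAt φ a) * ψ := funext hψeq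
      conv_lhs => rw [this]
      rw [analyticOrderAt_mul hprod (hψ.analyticOnNhd hD b hbD), hprod0, zero_add]
    obtain ⟨ψ', hψ', hb0, hψ'eq⟩ := exists_eq_sub_pow_mul hD hψ hbD (hord ▸ hbt)
    refine ⟨ψ', hψ', ?_, fun z => ?_⟩
    · intro a ha
      rcases Finset.mem_insert.1 ha with rfl | ha
      · exact hb0
      · intro h
        exact hψ0 a ha (by rw [hψ'eq, h, mul_zero])
    · rw [hψeq z, hψ'eq z, Finset.prod_insert hb, analyticOrderNatAt, analyticOrderNatAt, hord]
      ring

/-- The argument principle: the logarithmic derivative of `φ` differs from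
`∑ₐ ord_a(φ) / (z - a)` by a holomorphic function, whose integral vanishes. -/
theorem IsOrientedBoundary.argument_principle (hΓ : IsOrientedBoundary Γ V) (hD : IsOpen D)
    (hV : IsOpen V) (hVD : closure V ⊆ D) (hφ : DifferentiableOn ℂ φ D)
    (h0 : ∀ z ∈ frontier V, φ z ≠ 0) (Z : Finset ℂ) (hZ : ∀ z, z ∈ Z ↔ z ∈ V ∧ φ z = 0) :
    (2 * Real.pi * Complex.I)⁻¹ * cycleIntegral Γ (fun z => deriv φ z / φ z) =
      ∑ a ∈ Z, (analyticOrderNatAt φ a : ℂ) := by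
  have hVb := hΓ.isBounded
  have hΓf : ∀ j, Γ j '' Icc 0 1 ⊆ frontier V := fun j => by
    rw [← hΓ.range_eq]; exact subset_iUnion (fun j => Γ j '' Icc 0 1) j
  have hfV : frontier V ⊆ closure V := frontier_subset_closure
  obtain ⟨ψ, hψ, hψZ, hψeq⟩ := exists_eq_prod_sub_pow_mul hD hφ Z fun a ha =>
    ⟨hVD (subset_closure ((hZ a).1 ha).1),
      analyticOrderAt_ne_top_of_ne_zero_on_frontier hD hV hVb hVD hφ h0 ((hZ a).1 ha).1⟩
  have hψK : ∀ z ∈ closure V, ψ z ≠ 0 := by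
    intro z hz h
    have hφz : φ z = 0 := by rw [hψeq, h, mul_zero]
    by_cases hzV : z ∈ V
    · exact hψZ z ((hZ z).2 ⟨hzV, hφz⟩) h
    · exact h0 z (by rw [hV.frontier_eq]; exact ⟨hz, hzV⟩) hφz
  have hO : IsOpen (D ∩ ψ ⁻¹' {0}ᶜ) :=
    hψ.continuousOn.isOpen_inter_preimage hD isOpen_compl_singleton
  have hlogψ : DifferentiableOn ℂ (logDeriv ψ) (D ∩ ψ ⁻¹' {0}ᶜ) :=
    ((hψ.deriv hD).mono inter_subset_left).div (hψ.mono inter_subset_left) fun z hz => hz.2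
  have hKO : closure V ⊆ D ∩ ψ ⁻¹' {0}ᶜ := fun z hz => ⟨hVD hz, hψK z hz⟩
  have hψint : cycleIntegral Γ (logDeriv ψ) = 0 :=
    cycleIntegral_eq_zero hVb.isCompact_closure hO hKO hΓ.closed (fun j => (hΓf j).trans hfV)
      hΓ.outside hlogψ
  have hne : ∀ z ∈ frontier V, ∀ a ∈ Z, z - a ≠ 0 := by
    intro z hz a ha h
    exact h0 z hz (by rw [sub_eq_zero.1 h]; exact ((hZ a).1 ha).2)
  have hlog : ∀ z ∈ frontier V, deriv φ z / φ z =
      ∑ a ∈ Z, (analyticOrderNatAt φ a : ℂ) * (z - a)⁻¹ + logDeriv ψ z := by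
    intro z hz
    have h1 : φ = fun z => (∏ a ∈ Z, (z - a) ^ analyticOrderNatAt φ a) * ψ z := funext hψeq
    have hzD := hVD (hfV hz)
    change logDeriv φ z = _
    conv_lhs => rw [h1]
    rw [logDeriv_mul z (Finset.prod_ne_zero_iff.2 fun a ha => pow_ne_zero _ (hne z hz a ha))
      (hψK z (hfV hz)) (by fun_prop) (hψ.differentiableAt (hD.mem_nhds hzD)),
      logDeriv_prod (f := fun a z => (z - a) ^ analyticOrderNatAt φ a)
        (fun a ha => pow_ne_zero _ (hne z hz a ha)) (fun a _ => by fun_prop)]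
    congr 1
    refine Finset.sum_congr rfl fun a _ => ?_
    rw [logDeriv_fun_pow (by fun_prop)]
    congr 1
    rw [logDeriv_apply, deriv_sub_const, deriv_id'', one_div]
  have hcont : ∀ a ∈ Z, ∀ j, ContinuousOn (fun z => (analyticOrderNatAt φ a : ℂ) * (z - a)⁻¹)
      (Γ j '' Icc 0 1) := fun a ha j =>
    continuousOn_const.mul ((continuousOn_id.sub continuousOn_const).inv₀
      fun z hz => hne z (hΓf j hz) a ha)
  rw [cycleIntegral_congr fun j z hz => hlog z (hΓf j hz),
    cycleIntegral_add hΓ.closed (fun j => continuousOn_finsetSum Z fun a ha => hcont a ha j)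
      (fun j => hlogψ.continuousOn.mono (((hΓf j).trans hfV).trans hKO)),
    cycleIntegral_finset_sum hΓ.closed Z hcont, hψint, add_zero, Finset.mul_sum]
  refine Finset.sum_congr rfl fun a ha => ?_
  rw [cycleIntegral_const_mul, cycleIntegral_sub_inv_eq, hΓ.inside a ((hZ a).1 ha).1, mul_one,
    mul_comm (analyticOrderNatAt φ a : ℂ), ← mul_assoc, inv_mul_cancel₀ Complex.two_pi_I_ne_zero,
    one_mul]

end argument

/-! ### The algebra `ℍ ⊗ ℂ` -/

-- Instance search does not find the next two instances from the algebra structure.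
instance : SMulCommClass ℂ (Quaternion ℂ) (Quaternion ℂ) :=
  @Algebra.to_smulCommClass ℂ (Quaternion ℂ) _ _ _

instance : IsScalarTower ℂ (Quaternion ℂ) (Quaternion ℂ) :=
  @IsScalarTower.right ℂ (Quaternion ℂ) _ _ _

/-- The map underlying the inclusion `incl` of `ℍ` in `ℍ ⊗ ℂ`. -/
def inclFun (q : ℍ) : Quaternion ℂ := ⟨q.re, q.imI, q.imJ, q.imK⟩

@[simp] theorem inclFun_re (q : ℍ) : (inclFun q).re = q.re := rfl
@[simp] theorem inclFun_imI (q : ℍ) : (inclFun q).imI = q.imI := rfl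
@[simp] theorem inclFun_imJ (q : ℍ) : (inclFun q).imJ = q.imJ := rfl
@[simp] theorem inclFun_imK (q : ℍ) : (inclFun q).imK = q.imK := rfl

/-- The inclusion `q ↦ 1 ⊗ q` of `ℍ` in `ℍ ⊗ ℂ`. -/
def incl : ℍ →+* Quaternion ℂ where
  toFun := inclFun
  map_one' := by ext <;> simp
  map_zero' := by ext <;> simp
  map_mul' p q := by ext <;> simp
  map_add' p q := by ext <;> simp

@[simp] theorem incl_re (q : ℍ) : (incl q).re = q.re := rfl
@[simp] theorem incl_imI (q : ℍ) : (incl q).imI = q.imI := rfl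
@[simp] theorem incl_imJ (q : ℍ) : (incl q).imJ = q.imJ := rfl
@[simp] theorem incl_imK (q : ℍ) : (incl q).imK = q.imK := rfl

@[simp] theorem reExt_re (w : Quaternion ℂ) : (reExt w).re = w.re.re := rfl
@[simp] theorem reExt_imI (w : Quaternion ℂ) : (reExt w).imI = w.imI.re := rfl
@[simp] theorem reExt_imJ (w : Quaternion ℂ) : (reExt w).imJ = w.imJ.re := rfl
@[simp] theorem reExt_imK (w : Quaternion ℂ) : (reExt w).imK = w.imK.re := rfl
@[simp] theorem imExt_re (w : Quaternion ℂ) : (imExt w).re = w.re.im := rfl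
@[simp] theorem imExt_imI (w : Quaternion ℂ) : (imExt w).imI = w.imI.im := rfl
@[simp] theorem imExt_imJ (w : Quaternion ℂ) : (imExt w).imJ = w.imJ.im := rfl
@[simp] theorem imExt_imK (w : Quaternion ℂ) : (imExt w).imK = w.imK.im := rfl
@[simp] theorem conjExt_re (w : Quaternion ℂ) : (conjExt w).re = conj w.re := rfl
@[simp] theorem conjExt_imI (w : Quaternion ℂ) : (conjExt w).imI = conj w.imI := rfl
@[simp] theorem conjExt_imJ (w : Quaternion ℂ) : (conjExt w).imJ = conj w.imJ := rfl
@[simp] theorem conjExt_imK (w : Quaternion ℂ) : (conjExt w).imK = conj w.imK := rfl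

theorem eq_incl_add_smul_incl (w : Quaternion ℂ) :
    w = incl (reExt w) + Complex.I • incl (imExt w) := by
  ext <;> simp [mul_comm Complex.I, Complex.re_add_im]

theorem reExt_mul (w w' : Quaternion ℂ) :
    reExt (w * w') = reExt w * reExt w' - imExt w * imExt w' := by
  ext <;> simp <;> ring

theorem imExt_mul (w w' : Quaternion ℂ) :
    imExt (w * w') = reExt w * imExt w' + imExt w * reExt w' := by
  ext <;> simp <;> ring

theorem reExt_conjExt (w : Quaternion ℂ) : reExt (conjExt w) = reExt w := by
  ext <;> simp

theorem imExt_conjExt (w : Quaternion ℂ) : imExt (conjExt w) = -imExt w := by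
  ext <;> simp

theorem conjExt_mul (w w' : Quaternion ℂ) : conjExt (w * w') = conjExt w * conjExt w' := by
  ext <;> simp

theorem Phi_eq_normSq (w : Quaternion ℂ) : Phi w = Quaternion.normSq w := by
  rw [Phi, Quaternion.normSq_def']

theorem Phi_mul (w w' : Quaternion ℂ) : Phi (w * w') = Phi w * Phi w' := by
  simp only [Phi_eq_normSq, map_mul]

theorem Phi_smul (c : ℂ) (w : Quaternion ℂ) : Phi (c • w) = c ^ 2 * Phi w := by
  simp only [Phi_eq_normSq, Quaternion.normSq_smul]

theorem Phi_zero : Phi 0 = 0 := by simp [Phi]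

theorem Phi_conjExt (w : Quaternion ℂ) : Phi (conjExt w) = conj (Phi w) := by
  simp [Phi]

theorem mul_star_eq_coe_Phi (w : Quaternion ℂ) : w * star w = (Phi w : Quaternion ℂ) := by
  rw [Quaternion.self_mul_star, Phi_eq_normSq]

/-- An element of `ℍ ⊗ ℂ` with `Φ ≠ 0` is not a right zero divisor. -/
theorem eq_zero_of_mul_eq_zero_of_Phi_ne_zero {w x : Quaternion ℂ} (hx : Phi x ≠ 0)
    (h : w * x = 0) : w = 0 := by
  have h1 : w * (x * star x) = 0 := by rw [← mul_assoc, h, zero_mul]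
  rw [mul_star_eq_coe_Phi, Quaternion.mul_coe_eq_smul] at h1
  exact (smul_eq_zero.1 h1).resolve_left hx

/-- A nonzero real quaternion is invertible in `ℍ ⊗ ℂ`. -/
theorem eq_zero_of_incl_mul_eq_zero {q : ℍ} (hq : q ≠ 0) {x : Quaternion ℂ}
    (h : incl q * x = 0) : x = 0 := by
  have h1 : incl q⁻¹ * (incl q * x) = 0 := by rw [h, mul_zero]
  rwa [← mul_assoc, ← map_mul, inv_mul_cancel₀ hq, map_one, one_mul] at h1

/-! ### Imaginary units and spheres -/

theorem mem_imagUnits_iff {v : ℍ} : v ∈ imagUnits ↔ v.re = 0 ∧ Quaternion.normSq v = 1 := by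
  constructor
  · intro hv
    have h := (rho_of_im_pos hv (z := Complex.I) (by simp)).1
    have hre : v.re = 0 := by simpa [rho] using h
    have hv' : v * v = -1 := by simpa [imagUnits, pow_two] using hv
    refine ⟨hre, ?_⟩
    have h0 := congrArg QuaternionAlgebra.re hv'
    simp [hre] at h0
    rw [Quaternion.normSq_def', hre]
    linarith
  · rintro ⟨hre, hn⟩
    rw [Quaternion.normSq_def', hre] at hn
    rw [imagUnits, Set.mem_ofPred_eq, pow_two]
    ext <;> simp [hre] <;> linarith

theorem neg_mem_imagUnits {v : ℍ} (hv : v ∈ imagUnits) : -v ∈ imagUnits := by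
  simpa [imagUnits] using hv

theorem star_eq_neg_of_mem_imagUnits {v : ℍ} (hv : v ∈ imagUnits) : star v = -v := by
  have h := (mem_imagUnits_iff.1 hv).1
  ext <;> simp [h]

theorem rho_neg_conj (v : ℍ) (z : ℂ) : rho (-v) (conj z) = rho v z := by simp [rho]

theorem star_rho {v : ℍ} (hv : v ∈ imagUnits) (z : ℂ) : star (rho v z) = rho (-v) z := by
  rw [rho, rho, star_add, star_mul, star_eq_neg_of_mem_imagUnits hv, Quaternion.star_coe,
    Quaternion.star_coe, Quaternion.coe_commutes]

/-- Points of the plane on the same sphere are equal or conjugate. -/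
theorem eq_or_eq_conj_of_rho_eq {v v' : ℍ} (hv : v ∈ imagUnits) (hv' : v' ∈ imagUnits) {z z' : ℂ}
    (h : rho v z = rho v' z') : z = z' ∨ z = conj z' := by
  obtain ⟨h1, h2⟩ := mem_imagUnits_iff.1 hv
  obtain ⟨h1', h2'⟩ := mem_imagUnits_iff.1 hv'
  have hre : z.re = z'.re := by
    have := congrArg QuaternionAlgebra.re h
    simpa [rho, h1, h1'] using this
  have h3 : v * (z.im : ℍ) = v' * (z'.im : ℍ) := by
    rw [rho, rho, hre] at h
    exact add_left_cancel h
  have h4 := congrArg Quaternion.normSq h3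
  rw [map_mul, map_mul, h2, h2', Quaternion.normSq_coe, Quaternion.normSq_coe, one_mul, one_mul,
    sq_eq_sq_iff_eq_or_eq_neg] at h4
  rcases h4 with h4 | h4
  · exact Or.inl (Complex.ext hre h4)
  · exact Or.inr (Complex.ext (by simpa using hre) (by simpa using h4))

theorem rhoExt_mul_left (v : ℍ) (c : ℂ) (w : Quaternion ℂ) (hv : v ∈ imagUnits) :
    rhoExt v (c • w) = rho v c * rhoExt v w := by
  have hv' : v * v = -1 := by simpa [imagUnits, pow_two] using hv
  have h1 : reExt (c • w) = c.re • reExt w - c.im • imExt w := by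
    ext <;> simp
  have h2 : imExt (c • w) = c.re • imExt w + c.im • reExt w := by
    ext <;> simp
  have h3 : v * (c.im : ℍ) = c.im • v := by
    rw [← Quaternion.coe_commutes, Quaternion.coe_mul_eq_smul]
  rw [rhoExt_eq, rhoExt_eq, h1, h2, rho, h3, add_mul, Quaternion.coe_mul_eq_smul]
  simp only [mul_add, smul_add, mul_smul_comm, smul_mul_assoc]
  rw [← mul_assoc v v, hv', neg_one_mul, smul_neg]
  abel

theorem eq_of_forall_rhoExt_eq {w w' : Quaternion ℂ}
    (h : ∀ v ∈ imagUnits, rhoExt v w = rhoExt v w') : w = w' := by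
  have hI : ∀ v : ℍ, rho v Complex.I = v := fun v => by simp [rho]
  rw [stem_unique (f := fun v => rhoExt v w) (z := Complex.I) (w := w) fun v _ => by rw [hI],
    stem_unique (f := fun v => rhoExt v w) (z := Complex.I) (w := w') fun v hv => by
      rw [hI, h v hv]]

/-- `ρ_v` kills `w` exactly when `ι + v` does on the left. -/
theorem mul_eq_zero_of_rhoExt_eq_zero {v : ℍ} (hv : v ∈ imagUnits) {w : Quaternion ℂ}
    (h : rhoExt v w = 0) : ((Complex.I : Quaternion ℂ) + incl v) * w = 0 := by
  have hv' : v * v = -1 := by simpa [imagUnits, pow_two] using hv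
  rw [rhoExt_eq] at h
  have h2 : reExt w = -(v * imExt w) := eq_neg_of_add_eq_zero_left h
  have h3 : v * reExt w = imExt w := by rw [h2, mul_neg, ← mul_assoc, hv']; simp
  rw [eq_incl_add_smul_incl w, add_mul, mul_add, mul_add, mul_smul_comm, mul_smul_comm, ← map_mul,
    ← map_mul, Quaternion.coe_mul_eq_smul, Quaternion.coe_mul_eq_smul, smul_smul, Complex.I_mul_I,
    h3, h2, map_neg]
  simp

theorem Phi_eq_zero_of_rhoExt_eq_zero {v : ℍ} (hv : v ∈ imagUnits) {w : Quaternion ℂ}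
    (h : rhoExt v w = 0) : Phi w = 0 := by
  by_contra hne
  have h1 := eq_zero_of_mul_eq_zero_of_Phi_ne_zero hne (mul_eq_zero_of_rhoExt_eq_zero hv h)
  have h2 := congrArg QuaternionAlgebra.re h1
  simp [(mem_imagUnits_iff.1 hv).1] at h2

/-- If `Φ (a + ι b) = 0`, then `|a| = |b|` and `a ⊥ b`, so that `v = b a⁻¹` is an imaginary unit
with `a + v b = 0`. -/
theorem exists_rhoExt_eq_zero {w : Quaternion ℂ} (h : Phi w = 0) :
    ∃ v ∈ imagUnits, rhoExt v w = 0 := by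
  have hre := congrArg Complex.re h
  have him := congrArg Complex.im h
  simp [Phi, pow_two] at hre him
  set a := reExt w with ha
  set b := imExt w with hb
  have h1 : Quaternion.normSq a = Quaternion.normSq b := by
    rw [Quaternion.normSq_def', Quaternion.normSq_def']
    simp [ha, hb]
    linarith
  by_cases ha0 : a = 0
  · have hb0 : b = 0 := by
      rw [ha0, map_zero] at h1
      exact Quaternion.normSq_eq_zero.1 h1.symm
    refine ⟨unitI, unitI_mem, ?_⟩
    rw [rhoExt_eq, ← ha, ← hb, ha0, hb0]
    simp
  · have hna : Quaternion.normSq a ≠ 0 := Quaternion.normSq_ne_zero.2 ha0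
    have hv : b * a⁻¹ ∈ imagUnits := by
      rw [mem_imagUnits_iff]
      refine ⟨?_, by rw [map_mul, Quaternion.normSq_inv, h1, mul_inv_cancel₀ (h1 ▸ hna)]⟩
      change (b * ((Quaternion.normSq a)⁻¹ • star a)).re = 0
      simp [ha, hb]
      right
      linarith
    refine ⟨b * a⁻¹, hv, ?_⟩
    have hv' : (b * a⁻¹) * (b * a⁻¹) = -1 := by simpa [imagUnits, pow_two] using hv
    have h2 : b = b * a⁻¹ * a := by rw [mul_assoc, inv_mul_cancel₀ ha0, mul_one]
    rw [rhoExt_eq, ← ha, ← hb]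
    nth_rewrite 2 [h2]
    rw [← mul_assoc, hv']
    simp

theorem exists_rhoExt_eq_zero_iff {w : Quaternion ℂ} :
    (∃ v ∈ imagUnits, rhoExt v w = 0) ↔ Phi w = 0 :=
  ⟨fun ⟨_, hv, h⟩ => Phi_eq_zero_of_rhoExt_eq_zero hv h, exists_rhoExt_eq_zero⟩

/-! ### Holomorphic stem functions -/

/-- The four complex coordinates of `ℍ ⊗ ℂ`. -/
def coord (i : Fin 4) (w : Quaternion ℂ) : ℂ := Quaternion.equivTuple ℂ w i

/-- The element of `ℍ ⊗ ℂ` with given coordinates. -/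
def ofCoord (g : Fin 4 → ℂ) : Quaternion ℂ := (Quaternion.equivTuple ℂ).symm g

theorem coord_zero (w : Quaternion ℂ) : coord 0 w = w.re := rfl
theorem coord_one (w : Quaternion ℂ) : coord 1 w = w.imI := rfl
theorem coord_two (w : Quaternion ℂ) : coord 2 w = w.imJ := rfl
theorem coord_three (w : Quaternion ℂ) : coord 3 w = w.imK := rfl

theorem forall_coord {P : (Quaternion ℂ → ℂ) → Prop} :
    (∀ i, P (coord i)) ↔ P (fun w => w.re) ∧ P (fun w => w.imI) ∧ P (fun w => w.imJ) ∧
      P (fun w => w.imK) := by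
  constructor
  · exact fun h => ⟨h 0, h 1, h 2, h 3⟩
  · rintro ⟨h0, h1, h2, h3⟩ i
    fin_cases i
    exacts [h0, h1, h2, h3]

theorem coord_ofCoord (g : Fin 4 → ℂ) (i : Fin 4) : coord i (ofCoord g) = g i :=
  congrFun ((Quaternion.equivTuple ℂ).apply_symm_apply g) i

theorem ext_coord {w w' : Quaternion ℂ} (h : ∀ i, coord i w = coord i w') : w = w' :=
  (Quaternion.equivTuple ℂ).injective (funext h)

theorem coord_smul (i : Fin 4) (c : ℂ) (w : Quaternion ℂ) : coord i (c • w) = c * coord i w := by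
  revert i
  exact (forall_coord (P := fun f => f (c • w) = c * f w)).2 (by simp)

theorem coord_conjExt (i : Fin 4) (w : Quaternion ℂ) : coord i (conjExt w) = conj (coord i w) := by
  revert i
  exact (forall_coord (P := fun f => f (conjExt w) = conj (f w))).2 (by simp)

theorem coord_zero_right (i : Fin 4) : coord i 0 = 0 := by
  simpa using coord_smul i 0 0

/-- Holomorphic maps `F : D → ℍ ⊗ ℂ = ℂ⁴` with `F (conj z) = conj (F z)`. -/
structure IsStem (D : Set ℂ) (F : ℂ → Quaternion ℂ) : Prop where
  diff : ∀ i, DifferentiableOn ℂ (fun z => coord i (F z)) D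
  symm : ∀ z ∈ D, F (conj z) = conjExt (F z)

/-- `F` induces `f`, in the sense that `f (x + v y) = ρ_v (F (x + ι y))` over `D`. -/
def Represents (D : Set ℂ) (f : ℍ → ℍ) (F : ℂ → Quaternion ℂ) : Prop :=
  ∀ z ∈ D, ∀ v ∈ imagUnits, f (rho v z) = rhoExt v (F z)

variable {D : Set ℂ} {F G : ℂ → Quaternion ℂ} {f g : ℍ → ℍ}

theorem IsStem.differentiableOn_re (hF : IsStem D F) :
    DifferentiableOn ℂ (fun z => (F z).re) D := hF.diff 0
theorem IsStem.differentiableOn_imI (hF : IsStem D F) :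
    DifferentiableOn ℂ (fun z => (F z).imI) D := hF.diff 1
theorem IsStem.differentiableOn_imJ (hF : IsStem D F) :
    DifferentiableOn ℂ (fun z => (F z).imJ) D := hF.diff 2
theorem IsStem.differentiableOn_imK (hF : IsStem D F) :
    DifferentiableOn ℂ (fun z => (F z).imK) D := hF.diff 3

theorem IsStem.continuousAt_coord (hD : IsOpen D) (hF : IsStem D F) {z : ℂ} (hz : z ∈ D)
    (i : Fin 4) : ContinuousAt (fun z => coord i (F z)) z :=
  ((hF.diff i).differentiableAt (hD.mem_nhds hz)).continuousAt

theorem IsStem.differentiableOn_Phi (hF : IsStem D F) :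
    DifferentiableOn ℂ (fun z => Phi (F z)) D :=
  (((hF.differentiableOn_re.pow 2).add (hF.differentiableOn_imI.pow 2)).add
    (hF.differentiableOn_imJ.pow 2)).add (hF.differentiableOn_imK.pow 2)

theorem IsStem.mul (hF : IsStem D F) (hG : IsStem D G) : IsStem D (fun z => F z * G z) := by
  have f0 := hF.differentiableOn_re
  have f1 := hF.differentiableOn_imI
  have f2 := hF.differentiableOn_imJ
  have f3 := hF.differentiableOn_imK
  have g0 := hG.differentiableOn_re
  have g1 := hG.differentiableOn_imI
  have g2 := hG.differentiableOn_imJ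
  have g3 := hG.differentiableOn_imK
  refine ⟨(forall_coord (P := fun c => DifferentiableOn ℂ (fun z => c (F z * G z)) D)).2
    ⟨?_, ?_, ?_, ?_⟩, fun z hz => by rw [hF.symm z hz, hG.symm z hz, conjExt_mul]⟩
  · simp only [Quaternion.re_mul]; fun_prop
  · simp only [Quaternion.imI_mul]; fun_prop
  · simp only [Quaternion.imJ_mul]; fun_prop
  · simp only [Quaternion.imK_mul]; fun_prop

/-- The value at `z` of the map inducing the linear factor `q - p`. -/
def linFactor (p : ℍ) (z : ℂ) : Quaternion ℂ := (z : Quaternion ℂ) - incl p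

theorem isStem_linFactor (D : Set ℂ) (p : ℍ) : IsStem D (linFactor p) := by
  refine ⟨(forall_coord (P := fun c => DifferentiableOn ℂ (fun z => c (linFactor p z)) D)).2
    ⟨?_, ?_, ?_, ?_⟩, fun z hz => ?_⟩
  · simp only [linFactor, Quaternion.re_sub, Quaternion.re_coe]; fun_prop
  · simp only [linFactor, Quaternion.imI_sub, Quaternion.imI_coe]; fun_prop
  · simp only [linFactor, Quaternion.imJ_sub, Quaternion.imJ_coe]; fun_prop
  · simp only [linFactor, Quaternion.imK_sub, Quaternion.imK_coe]; fun_prop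
  · ext <;> simp [linFactor]

/-- The value at `z` of the map inducing `(q - p₁) ⋆ ⋯ ⋆ (q - pₙ)`. -/
def linProd (ps : List ℍ) (z : ℂ) : Quaternion ℂ := (ps.map fun p => linFactor p z).prod

theorem linProd_nil (z : ℂ) : linProd [] z = 1 := rfl

theorem linProd_cons (p : ℍ) (ps : List ℍ) (z : ℂ) :
    linProd (p :: ps) z = linFactor p z * linProd ps z := by simp [linProd]

theorem isStem_linProd_mul (ps : List ℍ) (hG : IsStem D G) :
    IsStem D (fun z => linProd ps z * G z) := by
  induction ps with
  | nil => simpa [linProd_nil] using hG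
  | cons p ps ih =>
    simp only [linProd_cons, mul_assoc]
    exact (isStem_linFactor D p).mul ih

/-! ### Stem functions and slice-regular functions -/

/-- The Cauchy-Riemann system for `α`, `β` makes each coordinate of `α + ι β` holomorphic. -/
theorem differentiableAt_stem_coord {α β : ℂ → ℍ} {z : ℂ} (hα : DifferentiableAt ℝ α z)
    (hβ : DifferentiableAt ℝ β z) (h1 : fderiv ℝ α z 1 = fderiv ℝ β z Complex.I)
    (h2 : fderiv ℝ α z Complex.I = -fderiv ℝ β z 1) (L : ℍ →L[ℝ] ℝ) :
    DifferentiableAt ℂ (fun z => (⟨L (α z), L (β z)⟩ : ℂ)) z := by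
  have hA : HasFDerivAt (fun z => (⟨L (α z), L (β z)⟩ : ℂ))
      (Complex.ofRealCLM ∘L (L ∘L fderiv ℝ α z) +
        Complex.I • (Complex.ofRealCLM ∘L (L ∘L fderiv ℝ β z))) z := by
    have hα' := Complex.ofRealCLM.hasFDerivAt.comp z (L.hasFDerivAt.comp z hα.hasFDerivAt)
    have hβ' := Complex.ofRealCLM.hasFDerivAt.comp z (L.hasFDerivAt.comp z hβ.hasFDerivAt)
    refine (hα'.add (hβ'.const_smul Complex.I)).congr_of_eventuallyEq
      (Eventually.of_forall fun w => ?_)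
    simp [Complex.mk_eq_add_mul_I, mul_comm]
  rw [differentiableAt_complex_iff_differentiableAt_real]
  refine ⟨hA.differentiableAt, ?_⟩
  rw [hA.fderiv]
  simp [h1, h2, mul_add, ← mul_assoc, add_comm]

/-- The coordinate functionals of `ℍ`. -/
theorem exists_coordinate_clm :
    ∃ L0 L1 L2 L3 : ℍ →L[ℝ] ℝ, (∀ q, L0 q = q.re) ∧ (∀ q, L1 q = q.imI) ∧ (∀ q, L2 q = q.imJ) ∧
      ∀ q, L3 q = q.imK :=
  ⟨⟨⟨⟨fun q => q.re, fun _ _ => rfl⟩, fun _ _ => by simp⟩, Quaternion.continuous_re⟩,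
    ⟨⟨⟨fun q => q.imI, fun _ _ => rfl⟩, fun _ _ => by simp⟩, Quaternion.continuous_imI⟩,
    ⟨⟨⟨fun q => q.imJ, fun _ _ => rfl⟩, fun _ _ => by simp⟩, Quaternion.continuous_imJ⟩,
    ⟨⟨⟨fun q => q.imK, fun _ _ => rfl⟩, fun _ _ => by simp⟩, Quaternion.continuous_imK⟩,
    fun _ => rfl, fun _ => rfl, fun _ => rfl, fun _ => rfl⟩

theorem IsSliceRegularOn.represents_stem (hDs : ∀ z ∈ D, conj z ∈ D) (hf : IsSliceRegularOn D f) :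
    Represents D f (stem f) :=
  fun _ hz => (stem_spec hDs hf hz).2

theorem IsSliceRegularOn.isStem_stem (hD : IsOpen D) (hDs : ∀ z ∈ D, conj z ∈ D)
    (hf : IsSliceRegularOn D f) : IsStem D (stem f) := by
  refine ⟨?_, fun z hz => (stem_spec hDs hf hz).1⟩
  obtain ⟨α, β, hα, hβ, h⟩ := hf
  obtain ⟨L0, L1, L2, L3, h0, h1, h2, h3⟩ := exists_coordinate_clm
  have key : ∀ L : ℍ →L[ℝ] ℝ,
      DifferentiableOn ℂ (fun z => (⟨L (alphaPart f z), L (betaPart f z)⟩ : ℂ)) D := by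
    intro L
    have : DifferentiableOn ℂ (fun z => (⟨L (α z), L (β z)⟩ : ℂ)) D := fun z hz =>
      (differentiableAt_stem_coord (hα.differentiableAt (hD.mem_nhds hz))
        (hβ.differentiableAt (hD.mem_nhds hz)) (h z hz).2.2.1 (h z hz).2.2.2.1
        L).differentiableWithinAt
    refine this.congr fun z hz => ?_
    rw [alphaPart_eq (h z hz).2.2.2.2, betaPart_eq (h z hz).2.2.2.2]
  refine (forall_coord (P := fun c => DifferentiableOn ℂ (fun z => c (stem f z)) D)).2
    ⟨?_, ?_, ?_, ?_⟩
  · have := key L0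
    simp only [h0] at this
    exact this
  · have := key L1
    simp only [h1] at this
    exact this
  · have := key L2
    simp only [h2] at this
    exact this
  · have := key L3
    simp only [h3] at this
    exact this

/-- The function induced by `G`. At a real point the imaginary unit is replaced by `0`, which is
harmless because `G` has no imaginary part there. -/
def ofStem (G : ℂ → Quaternion ℂ) (q : ℍ) : ℍ :=
  rhoExt (‖q.im‖⁻¹ • q.im) (G ⟨q.re, ‖q.im‖⟩)

theorem IsStem.imExt_eq_zero (hG : IsStem D G) {z : ℂ} (hz : z ∈ D) (him : z.im = 0) :
    imExt (G z) = 0 := by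
  have h1 := hG.symm z hz
  rw [Complex.conj_eq_iff_im.2 him] at h1
  refine eq_zero_of_eq_neg ?_
  rw [← imExt_conjExt, ← h1]

theorem IsStem.represents_ofStem (hG : IsStem D G) :
    Represents D (ofStem G) G := by
  have key : ∀ z : ℂ, 0 < z.im → ∀ v ∈ imagUnits, ofStem G (rho v z) = rhoExt v (G z) := by
    intro z hpos v hv
    obtain ⟨h1, h2, h3⟩ := rho_of_im_pos hv hpos
    have hzz : (⟨(rho v z).re, ‖(rho v z).im‖⟩ : ℂ) = z := Complex.ext h1 h2
    rw [ofStem, hzz, h3]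
  intro z hz v hv
  rcases lt_trichotomy z.im 0 with h | h | h
  · rw [← rho_neg_conj, key _ (by simpa using h) _ (neg_mem_imagUnits hv), hG.symm z hz,
      rhoExt_eq, rhoExt_eq, reExt_conjExt, imExt_conjExt, neg_mul_neg]
  · have hr : rho v z = (z.re : ℍ) := by simp [rho, h]
    have hzz : (⟨z.re, 0⟩ : ℂ) = z := Complex.ext rfl h.symm
    rw [ofStem, hr, Quaternion.im_coe, norm_zero, Quaternion.re_coe, hzz, rhoExt_eq, rhoExt_eq,
      hG.imExt_eq_zero hz h, mul_zero, mul_zero]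
  · exact key z h v hv

theorem reExt_eq_sum (w : Quaternion ℂ) : reExt w =
    w.re.re • (1 : ℍ) + w.imI.re • unitI + w.imJ.re • unitJ + w.imK.re • unitK := by
  ext <;> simp [unitI_re, unitI_imI, unitI_imJ, unitI_imK, unitJ_re, unitJ_imI, unitJ_imJ,
    unitJ_imK, unitK_re, unitK_imI, unitK_imJ, unitK_imK]

/-- Reduces derivatives of `imExt` to derivatives of `reExt`. -/
theorem imExt_eq_reExt (w : Quaternion ℂ) : imExt w = reExt (-Complex.I • w) := by
  ext <;> simp

theorem hasFDerivAt_reExt {F' : Fin 4 → ℂ} {z : ℂ}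
    (h : ∀ i, HasDerivAt (fun z => coord i (G z)) (F' i) z) :
    ∃ L : ℂ →L[ℝ] ℍ, HasFDerivAt (fun z => reExt (G z)) L z ∧
      ∀ c, L c = reExt (c • ofCoord F') := by
  have hr : ∀ i, HasFDerivAt (fun z => (coord i (G z)).re)
      (Complex.reCLM ∘L ((ContinuousLinearMap.toSpanSingleton ℂ (F' i)).restrictScalars ℝ)) z :=
    fun i => Complex.reCLM.hasFDerivAt.comp z ((h i).hasFDerivAt.restrictScalars ℝ)
  have := ((((hr 0).smul_const (1 : ℍ)).add ((hr 1).smul_const unitI)).add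
    ((hr 2).smul_const unitJ)).add ((hr 3).smul_const unitK)
  refine ⟨_, this.congr_of_eventuallyEq (Eventually.of_forall fun w => reExt_eq_sum _),
    fun c => ?_⟩
  rw [reExt_eq_sum]
  have hc : ∀ i, coord i (c • ofCoord F') = c * F' i := fun i => by
    rw [coord_smul, coord_ofCoord]
  have c0 := hc 0
  have c1 := hc 1
  have c2 := hc 2
  have c3 := hc 3
  rw [coord_zero] at c0
  rw [coord_one] at c1
  rw [coord_two] at c2
  rw [coord_three] at c3
  rw [c0, c1, c2, c3]
  simp

theorem IsStem.isSliceRegularOn (hD : IsOpen D) (hG : IsStem D G)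
    (hg : Represents D g G) : IsSliceRegularOn D g := by
  have hd : ∀ z ∈ D, ∃ A B : ℂ →L[ℝ] ℍ, HasFDerivAt (fun z => reExt (G z)) A z ∧
      HasFDerivAt (fun z => imExt (G z)) B z ∧ A 1 = B Complex.I ∧ A Complex.I = -B 1 := by
    intro z hz
    have h1 : ∀ i, HasDerivAt (fun z => coord i (G z)) (deriv (fun z => coord i (G z)) z) z :=
      fun i => ((hG.diff i).differentiableAt (hD.mem_nhds hz)).hasDerivAt
    obtain ⟨A, hA, hA'⟩ := hasFDerivAt_reExt h1
    have h2 : ∀ i, HasDerivAt (fun z => coord i (-Complex.I • G z))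
        (-Complex.I * deriv (fun z => coord i (G z)) z) z := fun i => by
      simp only [coord_smul]
      exact (h1 i).const_mul _
    obtain ⟨B, hB, hB'⟩ := hasFDerivAt_reExt h2
    have h3 : ofCoord (fun i => -Complex.I * deriv (fun z => coord i (G z)) z) =
        -Complex.I • ofCoord (fun i => deriv (fun z => coord i (G z)) z) :=
      ext_coord fun i => by rw [coord_smul, coord_ofCoord, coord_ofCoord]
    refine ⟨A, B, hA, by simpa only [imExt_eq_reExt] using hB, ?_, ?_⟩
    · rw [hA', hB', h3, smul_smul]
      simp
    · rw [hA', hB', h3, one_smul]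
      ext <;> simp
  refine ⟨fun z => reExt (G z), fun z => imExt (G z), fun z hz => ?_, fun z hz => ?_,
    fun z hz => ⟨?_, ?_, ?_, ?_, fun v hv => by rw [hg z hz v hv, rhoExt_eq]⟩⟩
  · obtain ⟨A, B, hA, -⟩ := hd z hz
    exact hA.differentiableAt.differentiableWithinAt
  · obtain ⟨A, B, -, hB, -⟩ := hd z hz
    exact hB.differentiableAt.differentiableWithinAt
  · simp only [hG.symm z hz, reExt_conjExt]
  · simp only [hG.symm z hz, imExt_conjExt]
  · obtain ⟨A, B, hA, hB, h, -⟩ := hd z hz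
    rw [hA.fderiv, hB.fderiv, h]
  · obtain ⟨A, B, hA, hB, -, h⟩ := hd z hz
    rw [hA.fderiv, hB.fderiv, h]

/-- The `⋆`-product is induced by the product in `ℍ ⊗ ℂ`. -/
theorem Represents.starMul (hDs : ∀ z ∈ D, conj z ∈ D) (hF : IsStem D F) (hG : IsStem D G)
    (hf : Represents D f F) (hg : Represents D g G) :
    Represents D (starMul f g) (fun z => F z * G z) := by
  intro z hz v hv
  have := starMul_spec (f := f) (g := g) (α := fun z => reExt (F z)) (β := fun z => imExt (F z))
    (γ := fun z => reExt (G z)) (δ := fun z => imExt (G z)) hDs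
    (fun z hz => by simp only [hF.symm z hz, imExt_conjExt])
    (fun z hz => by simp only [hG.symm z hz, imExt_conjExt])
    (fun z hz => by simp only [hF.symm z hz, reExt_conjExt])
    (fun z hz => by simp only [hG.symm z hz, reExt_conjExt])
    (fun z hz v hv => by rw [hf z hz v hv, rhoExt_eq])
    (fun z hz v hv => by rw [hg z hz v hv, rhoExt_eq]) hz hv
  rw [this, rhoExt_eq, reExt_mul, imExt_mul]

theorem rhoExt_coe (v : ℍ) (c : ℂ) : rhoExt v (c : Quaternion ℂ) = rho v c := by
  simp [rhoExt, rho]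

theorem represents_sub (D : Set ℂ) (p : ℍ) : Represents D (fun q => q - p) (linFactor p) := by
  intro z hz v hv
  have h1 : reExt (linFactor p z) = z.re - p := by
    ext <;> simp [linFactor]
  have h2 : imExt (linFactor p z) = z.im := by
    ext <;> simp [linFactor]
  rw [rhoExt_eq, h1, h2, rho]
  exact add_sub_right_comm _ _ _

theorem Represents.starLinearFactors (hDs : ∀ z ∈ D, conj z ∈ D) (hG : IsStem D G)
    (hg : Represents D g G) (ps : List ℍ) :
    Represents D (starLinearFactors ps g) (fun z => linProd ps z * G z) := by
  induction ps with
  | nil => simpa [SliceRegular.starLinearFactors, linProd_nil] using hg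
  | cons p ps ih =>
    simp only [linProd_cons, mul_assoc]
    exact (represents_sub D p).starMul hDs (isStem_linFactor D p) (isStem_linProd_mul ps hG) ih

/-! ### Linear factors on a sphere -/

/-- The complex polynomial `(z - x)² + y²` inducing the factor of the sphere of `z₀ = x + ι y`. -/
def spherePoly (z₀ z : ℂ) : ℂ := (z - z₀.re) ^ 2 + (z₀.im : ℂ) ^ 2

theorem spherePoly_eq_mul (z₀ z : ℂ) : spherePoly z₀ z = (z - z₀) * (z - conj z₀) := by
  have h1 : z₀ = z₀.re + z₀.im * Complex.I := (Complex.re_add_im z₀).symm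
  have h2 : conj z₀ = z₀.re - z₀.im * Complex.I := by
    apply Complex.ext <;> simp
  rw [h2, spherePoly]
  conv_rhs => rw [h1]
  simp only [Complex.add_re, Complex.add_im, Complex.ofReal_re, Complex.ofReal_im, Complex.mul_re,
    Complex.mul_im, Complex.I_re, Complex.I_im]
  push_cast
  linear_combination (z₀.im : ℂ) ^ 2 * Complex.I_sq

theorem spherePoly_self (z₀ : ℂ) : spherePoly z₀ z₀ = 0 := by simp [spherePoly_eq_mul]

theorem spherePoly_conj_left (z₀ z : ℂ) : spherePoly (conj z₀) z = spherePoly z₀ z := by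
  simp [spherePoly]

theorem spherePoly_conj (z₀ z : ℂ) : spherePoly z₀ (conj z) = conj (spherePoly z₀ z) := by
  simp [spherePoly]

theorem eventually_spherePoly_ne_zero (z₀ z : ℂ) : ∀ᶠ w in 𝓝[≠] z, spherePoly z₀ w ≠ 0 := by
  have h : ∀ a : ℂ, ∀ᶠ w in 𝓝[≠] z, w - a ≠ 0 := by
    intro a
    rcases eq_or_ne a z with rfl | ha
    · filter_upwards [self_mem_nhdsWithin] with w hw using sub_ne_zero.2 hw
    · filter_upwards [nhdsWithin_le_nhds (isOpen_ne.mem_nhds ha.symm)] with w hw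
        using sub_ne_zero.2 hw
  filter_upwards [h z₀, h (conj z₀)] with w h1 h2
  rw [spherePoly_eq_mul]
  exact mul_ne_zero h1 h2

theorem rho_mul {v : ℍ} (hv : v ∈ imagUnits) (c d : ℂ) : rho v (c * d) = rho v c * rho v d := by
  have h := rhoExt_mul_left v c (d : Quaternion ℂ) hv
  have h2 : c • (d : Quaternion ℂ) = ((c * d : ℂ) : Quaternion ℂ) := by ext <;> simp
  rwa [h2, rhoExt_coe, rhoExt_coe] at h

theorem rhoExt_pow_smul {v : ℍ} (hv : v ∈ imagUnits) (c : ℂ) (m : ℕ) (w : Quaternion ℂ) :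
    rhoExt v (c ^ m • w) = rho v c ^ m * rhoExt v w := by
  induction m with
  | zero => simp
  | succ m ih => rw [pow_succ', mul_smul, rhoExt_mul_left v _ _ hv, ih, pow_succ', mul_assoc]

theorem sphereFactor_rho {v : ℍ} (hv : v ∈ imagUnits) (z₀ z : ℂ) :
    sphereFactor z₀ (rho v z) = rho v (spherePoly z₀ z) := by
  have h1 : rho v z - (z₀.re : ℍ) = rho v (z - z₀.re) := by
    simp only [rho, Complex.sub_re, Complex.sub_im, Complex.ofReal_re, Complex.ofReal_im, sub_zero,
      Quaternion.coe_sub]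
    exact add_sub_right_comm _ _ _
  have h2 : ∀ c d : ℂ, rho v (c + d) = rho v c + rho v d := fun c d => by
    simp only [rho, Complex.add_re, Complex.add_im, Quaternion.coe_add, mul_add]
    exact add_add_add_comm _ _ _ _
  have h3 : rho v ((z₀.im : ℂ) ^ 2) = (z₀.im : ℍ) ^ 2 := by
    rw [← Complex.ofReal_pow, rho, Complex.ofReal_re, Complex.ofReal_im, Quaternion.coe_zero,
      mul_zero, add_zero, Quaternion.coe_pow]
  rw [sphereFactor, h1, spherePoly, h2, h3, pow_two (rho v _), pow_two (z - _), rho_mul hv]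

theorem star_mem_sphereOf {z₀ : ℂ} {p : ℍ} (hp : p ∈ sphereOf z₀) : star p ∈ sphereOf z₀ := by
  obtain ⟨v, hv, rfl⟩ := hp
  exact ⟨-v, neg_mem_imagUnits hv, star_rho hv z₀⟩

theorem star_linFactor (p : ℍ) (z : ℂ) : star (linFactor p z) = linFactor (star p) z := by
  ext <;> simp [linFactor]

theorem Phi_linFactor {z₀ : ℂ} {p : ℍ} (hp : p ∈ sphereOf z₀) (z : ℂ) :
    Phi (linFactor p z) = spherePoly z₀ z := by
  obtain ⟨v, hv, rfl⟩ := hp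
  obtain ⟨h1, h2⟩ := mem_imagUnits_iff.1 hv
  rw [Quaternion.normSq_def', h1] at h2
  have h3 : (v.imI : ℂ) ^ 2 + (v.imJ : ℂ) ^ 2 + (v.imK : ℂ) ^ 2 = 1 := by
    have : v.imI ^ 2 + v.imJ ^ 2 + v.imK ^ 2 = 1 := by linarith
    exact_mod_cast this
  simp [Phi, linFactor, rho, spherePoly, h1]
  linear_combination (z₀.im : ℂ) ^ 2 * h3

theorem linFactor_mul_linFactor_star {z₀ : ℂ} {p : ℍ} (hp : p ∈ sphereOf z₀) (z : ℂ) :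
    linFactor p z * linFactor (star p) z = (spherePoly z₀ z : Quaternion ℂ) := by
  rw [← star_linFactor, mul_star_eq_coe_Phi, Phi_linFactor hp]

theorem linFactor_star_mul_linFactor {z₀ : ℂ} {p : ℍ} (hp : p ∈ sphereOf z₀) (z : ℂ) :
    linFactor (star p) z * linFactor p z = (spherePoly z₀ z : Quaternion ℂ) := by
  have := linFactor_mul_linFactor_star (star_mem_sphereOf hp) z
  rwa [star_star] at this

theorem Phi_linProd {z₀ : ℂ} {ps : List ℍ} (hps : ∀ p ∈ ps, p ∈ sphereOf z₀) (z : ℂ) :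
    Phi (linProd ps z) = spherePoly z₀ z ^ ps.length := by
  induction ps with
  | nil => simp [linProd_nil, Phi_eq_normSq]
  | cons p ps ih =>
    rw [linProd_cons, Phi_mul, Phi_linFactor (hps p List.mem_cons_self),
      ih fun q hq => hps q (List.mem_cons_of_mem p hq), List.length_cons, pow_succ']

theorem linFactor_ne_zero {z₀ : ℂ} (h : z₀.im ≠ 0) (p : ℍ) : linFactor p z₀ ≠ 0 := by
  intro h0
  have := congrArg Complex.im (congrArg QuaternionAlgebra.re h0)
  simp [linFactor, h] at this

/-- If the linear factors of `p` and `p'` satisfy `(z₀ - p) (z₀ - p') x = 0`, where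
`(z₀ - p') x ≠ 0`, then `p'` is conjugate to `p`: the element `(z₀ - p') x` is killed by both
`z₀ - p` and `z₀ - star p'`, hence by the real quaternion `p - star p'`. -/
theorem eq_star_of_linFactor_mul_eq_zero {z₀ : ℂ} {p p' : ℍ} (hp' : p' ∈ sphereOf z₀)
    {x : Quaternion ℂ} (hne : linFactor p' z₀ * x ≠ 0)
    (h : linFactor p z₀ * (linFactor p' z₀ * x) = 0) : p' = star p := by
  by_contra hpp
  have h1 : linFactor (star p') z₀ * (linFactor p' z₀ * x) = 0 := by
    rw [← mul_assoc, linFactor_star_mul_linFactor hp', spherePoly_self, Quaternion.coe_zero,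
        zero_mul]
  have h2 : incl (star p' - p) * (linFactor p' z₀ * x) = 0 := by
    have : incl (star p' - p) = linFactor p z₀ - linFactor (star p') z₀ := by
      rw [map_sub, linFactor, linFactor, sub_sub_sub_cancel_left]
    rw [this, sub_mul, h, h1, sub_zero]
  refine hne (eq_zero_of_incl_mul_eq_zero (fun h3 => hpp ?_) h2)
  rw [← sub_eq_zero.1 h3, star_star]

/-- A product of linear factors without consecutive conjugate points does not vanish on their
sphere. -/
theorem linProd_mul_ne_zero {z₀ : ℂ} (him : z₀.im ≠ 0) {ps : List ℍ}
    (hps : ∀ p ∈ ps, p ∈ sphereOf z₀) (hchain : ps.IsChain (fun a b => b ≠ star a))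
    {x : Quaternion ℂ} (hx : Phi x ≠ 0) : linProd ps z₀ * x ≠ 0 := by
  induction ps with
  | nil =>
    rw [linProd_nil, one_mul]
    rintro rfl
    exact hx Phi_zero
  | cons p ps ih =>
    have ih' := ih (fun q hq => hps q (List.mem_cons_of_mem p hq)) hchain.of_cons
    intro h
    rw [linProd_cons, mul_assoc] at h
    cases ps with
    | nil =>
      rw [linProd_nil, one_mul] at h
      exact linFactor_ne_zero him p (eq_zero_of_mul_eq_zero_of_Phi_ne_zero hx h)
    | cons p' ps =>
      rw [linProd_cons, mul_assoc] at h ih'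
      exact (List.isChain_cons_cons.1 hchain).1
        (eq_star_of_linFactor_mul_eq_zero (hps p' (by simp)) ih' h)

theorem isChain_of_linProd_mul_ne_zero {z₀ : ℂ} {ps : List ℍ}
    (hps : ∀ p ∈ ps, p ∈ sphereOf z₀) {x : Quaternion ℂ} (h : linProd ps z₀ * x ≠ 0) :
    ps.IsChain (fun a b => b ≠ star a) := by
  induction ps with
  | nil => exact List.isChain_nil
  | cons p ps ih =>
    rw [linProd_cons, mul_assoc] at h
    have ih' := ih (fun q hq => hps q (List.mem_cons_of_mem p hq)) (right_ne_zero_of_mul h)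
    cases ps with
    | nil => exact List.isChain_singleton p
    | cons p' ps =>
      refine List.isChain_cons_cons.2 ⟨?_, ih'⟩
      rintro rfl
      apply h
      rw [linProd_cons, mul_assoc, ← mul_assoc,
        linFactor_mul_linFactor_star (hps p (by simp)), spherePoly_self, Quaternion.coe_zero,
        zero_mul]

/-! ### Division of stem functions -/

theorem eq_of_eventuallyEq_punctured {u w : ℂ → ℂ} {z : ℂ} (hu : ContinuousAt u z)
    (hw : ContinuousAt w z) (h : ∀ᶠ y in 𝓝[≠] z, u y = w y) : u z = w z :=
  tendsto_nhds_unique_of_eventuallyEq (hu.tendsto.mono_left nhdsWithin_le_nhds)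
    (hw.tendsto.mono_left nhdsWithin_le_nhds) h

theorem eq_of_smul_eq_smul (hD : IsOpen D) {P : ℂ → ℂ} (hP : ∀ z, ∀ᶠ w in 𝓝[≠] z, P w ≠ 0)
    (hF : IsStem D F) (hG : IsStem D G) (h : ∀ z ∈ D, P z • F z = P z • G z) {z : ℂ} (hz : z ∈ D) :
    F z = G z := by
  refine ext_coord fun i => eq_of_eventuallyEq_punctured (hF.continuousAt_coord hD hz i)
    (hG.continuousAt_coord hD hz i) ?_
  filter_upwards [hP z, nhdsWithin_le_nhds (hD.mem_nhds hz)] with w hw hwD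
  have h1 := congrArg (coord i) (h w hwD)
  rw [coord_smul, coord_smul] at h1
  exact mul_left_cancel₀ hw h1

/-- A quotient of a stem function by a real polynomial is one, once its coordinates extend
holomorphically: the symmetry persists at the zeros of the divisor by continuity. -/
theorem IsStem.exists_eq_smul (hD : IsOpen D) (hDs : ∀ z ∈ D, conj z ∈ D) (hF : IsStem D F)
    {P : ℂ → ℂ} (hP : ∀ z, ∀ᶠ w in 𝓝[≠] z, P w ≠ 0) (hPc : ∀ z, P (conj z) = conj (P z))
    (h : ∀ i, ∃ g : ℂ → ℂ, DifferentiableOn ℂ g D ∧ ∀ z ∈ D, coord i (F z) = P z * g z) :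
    ∃ G, IsStem D G ∧ ∀ z ∈ D, F z = P z • G z := by
  choose g hg hgeq using h
  refine ⟨fun z => ofCoord fun i => g i z, ⟨fun i => by simpa only [coord_ofCoord] using hg i,
    fun z hz => ?_⟩, fun z hz => ext_coord fun i => by rw [coord_smul, coord_ofCoord, hgeq i z hz]⟩
  refine ext_coord fun i => ?_
  rw [coord_conjExt, coord_ofCoord, coord_ofCoord]
  have hc : ∀ w ∈ D, ContinuousAt (g i) w := fun w hw =>
    ((hg i).differentiableAt (hD.mem_nhds hw)).continuousAt
  refine eq_of_eventuallyEq_punctured (u := fun z => g i (conj z)) (w := fun z => conj (g i z))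
    (ContinuousAt.comp (hc _ (hDs z hz)) Complex.continuous_conj.continuousAt)
    (Complex.continuous_conj.continuousAt.comp (hc z hz)) ?_
  filter_upwards [hP z, nhdsWithin_le_nhds (hD.mem_nhds hz)] with w hw hwD
  have h1 := hgeq i _ (hDs w hwD)
  rw [hF.symm w hwD, coord_conjExt, hgeq i w hwD, hPc, map_mul] at h1
  exact (mul_left_cancel₀ ((map_ne_zero _).2 hw) h1).symm

theorem exists_eq_sub_mul {u : ℂ → ℂ} (hD : IsOpen D) (hu : DifferentiableOn ℂ u D) {a : ℂ}
    (ha : a ∈ D) (h0 : u a = 0) :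
    ∃ w : ℂ → ℂ, DifferentiableOn ℂ w D ∧ ∀ z, u z = (z - a) * w z := by
  refine ⟨dslope u a, (Complex.differentiableOn_dslope (hD.mem_nhds ha)).2 hu, fun z => ?_⟩
  have := sub_smul_dslope u a z
  rw [smul_eq_mul, h0, sub_zero] at this
  exact this.symm

theorem IsStem.exists_eq_spherePoly_smul (hD : IsOpen D) (hDs : ∀ z ∈ D, conj z ∈ D)
    (hF : IsStem D F) {z₀ : ℂ} (hz₀ : z₀ ∈ D) (him : z₀.im ≠ 0) (h0 : F z₀ = 0) :
    ∃ G, IsStem D G ∧ ∀ z ∈ D, F z = spherePoly z₀ z • G z := by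
  refine hF.exists_eq_smul hD hDs (eventually_spherePoly_ne_zero z₀) (spherePoly_conj z₀)
    fun i => ?_
  obtain ⟨w, hw, hweq⟩ := exists_eq_sub_mul hD (hF.diff i) hz₀ (by rw [h0, coord_zero_right])
  have hne : conj z₀ - z₀ ≠ 0 := fun h => him (Complex.conj_eq_iff_im.1 (sub_eq_zero.1 h))
  have hwc : w (conj z₀) = 0 := by
    have h1 := hweq (conj z₀)
    rw [hF.symm z₀ hz₀, coord_conjExt, h0, coord_zero_right, map_zero] at h1
    exact (mul_eq_zero.1 h1.symm).resolve_left hne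
  obtain ⟨w', hw', hweq'⟩ := exists_eq_sub_mul hD hw (hDs z₀ hz₀) hwc
  exact ⟨w', hw', fun z _ => by rw [hweq, hweq', spherePoly_eq_mul, mul_assoc]⟩

theorem IsStem.exists_eq_sub_smul (hD : IsOpen D) (hDs : ∀ z ∈ D, conj z ∈ D)
    (hF : IsStem D F) {z₀ : ℂ} (hz₀ : z₀ ∈ D) (him : z₀.im = 0) (h0 : F z₀ = 0) :
    ∃ G, IsStem D G ∧ ∀ z ∈ D, F z = (z - z₀) • G z := by
  refine hF.exists_eq_smul (P := fun z => z - z₀) hD hDs (fun z => ?_) (fun z => ?_) fun i => ?_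
  · filter_upwards [eventually_spherePoly_ne_zero z₀ z] with w hw
    rw [spherePoly_eq_mul] at hw
    exact left_ne_zero_of_mul hw
  · rw [map_sub, Complex.conj_eq_iff_im.2 him]
  · obtain ⟨w, hw, hweq⟩ := exists_eq_sub_mul hD (hF.diff i) hz₀ (by rw [h0, coord_zero_right])
    exact ⟨w, hw, fun z _ => hweq z⟩

/-- A zero of the induced function on a sphere splits off a linear factor. -/
theorem IsStem.exists_eq_linFactor_mul (hD : IsOpen D) (hDs : ∀ z ∈ D, conj z ∈ D)
    (hF : IsStem D F) {z₀ : ℂ} (hz₀ : z₀ ∈ D) (him : z₀.im ≠ 0) (h0 : Phi (F z₀) = 0) :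
    ∃ p ∈ sphereOf z₀, ∃ G, IsStem D G ∧ ∀ z ∈ D, F z = linFactor p z * G z := by
  obtain ⟨v, hv, hvF⟩ := exists_rhoExt_eq_zero h0
  have hp : rho v z₀ ∈ sphereOf z₀ := ⟨v, hv, rfl⟩
  have hkill : linFactor (star (rho v z₀)) z₀ * F z₀ = 0 := by
    have h1 : linFactor (star (rho v z₀)) z₀ =
        ((z₀.im : ℂ) : Quaternion ℂ) * ((Complex.I : Quaternion ℂ) + incl v) := by
      rw [star_rho hv]
      have hre : (z₀ : ℂ) - z₀.re = z₀.im * Complex.I := by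
        linear_combination -Complex.re_add_im z₀
      have := (mem_imagUnits_iff.1 hv).1
      ext <;> simp [linFactor, rho, this, hre] <;> ring
    rw [h1, mul_assoc, mul_eq_zero_of_rhoExt_eq_zero hv hvF, mul_zero]
  obtain ⟨G, hG, hGeq⟩ := ((isStem_linFactor D (star (rho v z₀))).mul hF).exists_eq_spherePoly_smul
    hD hDs hz₀ him hkill
  refine ⟨rho v z₀, hp, G, hG, fun z hz => ?_⟩
  refine eq_of_smul_eq_smul hD (eventually_spherePoly_ne_zero z₀) hF
    ((isStem_linFactor D (rho v z₀)).mul hG) (fun z hz => ?_) hz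
  rw [← mul_smul_comm, ← hGeq z hz, ← mul_assoc, linFactor_mul_linFactor_star hp,
    Quaternion.coe_mul_eq_smul]

/-! ### Existence and uniqueness of multiplicities -/

/-- The counterpart of `HasMultiplicities` for the map `F` inducing `f`: the factorization is one in
`ℍ ⊗ ℂ`, and the absence of zeros of `g` on the sphere of `z₀` reads `Φ (G z₀) ≠ 0`. -/
def StemHasMultiplicities (D : Set ℂ) (F : ℂ → Quaternion ℂ) (z₀ : ℂ) (m n : ℕ) : Prop :=
  ∃ (ps : List ℍ) (G : ℂ → Quaternion ℂ),
    ps.length = n ∧ (∀ p ∈ ps, p ∈ sphereOf z₀) ∧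
    (z₀.im ≠ 0 → ps.IsChain (fun a b => b ≠ star a)) ∧ (z₀.im = 0 → m = 0) ∧
    IsStem D G ∧ Phi (G z₀) ≠ 0 ∧ ∀ z ∈ D, F z = spherePoly z₀ z ^ m • (linProd ps z * G z)

theorem Represents.forall_sphereOf_ne_zero_iff (hg : Represents D g G) {z : ℂ} (hz : z ∈ D) :
    (∀ q ∈ sphereOf z, g q ≠ 0) ↔ Phi (G z) ≠ 0 := by
  rw [← not_iff_not, not_not, ← exists_rhoExt_eq_zero_iff]
  push Not
  constructor
  · rintro ⟨_, ⟨v, hv, rfl⟩, h⟩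
    exact ⟨v, hv, by rwa [← hg z hz v hv]⟩
  · rintro ⟨v, hv, h⟩
    exact ⟨_, ⟨v, hv, rfl⟩, by rwa [hg z hz v hv]⟩

theorem hasMultiplicities_iff (hD : IsOpen D) (hDs : ∀ z ∈ D, conj z ∈ D) (hf : Represents D f F)
    {z₀ : ℂ} (hz₀ : z₀ ∈ D) {m n : ℕ} :
    HasMultiplicities D f z₀ m n ↔ StemHasMultiplicities D F z₀ m n := by
  constructor
  · rintro ⟨ps, g, h1, h2, h3, h4, hg, h5, h6⟩
    have hG := hg.isStem_stem hD hDs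
    have hgG := hg.represents_stem hDs
    refine ⟨ps, stem g, h1, h2, h3, h4, hG, (hgG.forall_sphereOf_ne_zero_iff hz₀).1 h5,
      fun z hz => eq_of_forall_rhoExt_eq fun v hv => ?_⟩
    rw [← hf z hz v hv, h6 _ ⟨z, hz, v, hv, rfl⟩, sphereFactor_rho hv, rhoExt_pow_smul hv,
      hgG.starLinearFactors hDs hG ps z hz v hv]
  · rintro ⟨ps, G, h1, h2, h3, h4, hG, h5, h6⟩
    have hgG := hG.represents_ofStem
    refine ⟨ps, ofStem G, h1, h2, h3, h4, hG.isSliceRegularOn hD hgG,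
      (hgG.forall_sphereOf_ne_zero_iff hz₀).2 h5, ?_⟩
    rintro _ ⟨z, hz, v, hv, rfl⟩
    rw [hf z hz v hv, h6 z hz, sphereFactor_rho hv, rhoExt_pow_smul hv,
      hgG.starLinearFactors hDs hG ps z hz v hv]

/-- The order of `(z - x)² + y²` at `x + ι y`. -/
theorem analyticOrderAt_spherePoly (z₀ : ℂ) :
    analyticOrderAt (spherePoly z₀) z₀ = if z₀.im = 0 then 2 else 1 := by
  have han : AnalyticAt ℂ (spherePoly z₀) z₀ := by unfold spherePoly; fun_prop
  split_ifs with him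
  · refine (han.analyticOrderAt_eq_natCast (n := 2)).2 ⟨fun _ => 1, by fun_prop, one_ne_zero,
      Eventually.of_forall fun z => ?_⟩
    rw [spherePoly_eq_mul, Complex.conj_eq_iff_im.2 him, smul_eq_mul, mul_one, pow_two]
  · refine (han.analyticOrderAt_eq_natCast (n := 1)).2 ⟨fun z => z - conj z₀, by fun_prop, ?_,
      Eventually.of_forall fun z => ?_⟩
    · exact fun h => him (Complex.conj_eq_iff_im.1 (sub_eq_zero.1 h).symm)
    · rw [spherePoly_eq_mul, smul_eq_mul, pow_one]

theorem analyticOrderAt_spherePoly_pow_mul (hD : IsOpen D) {z₀ : ℂ} (hz₀ : z₀ ∈ D)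
    {φ ψ : ℂ → ℂ} (hψ : DifferentiableOn ℂ ψ D) {k : ℕ}
    (h : ∀ z ∈ D, φ z = spherePoly z₀ z ^ k * ψ z) :
    analyticOrderAt φ z₀ = k * (if z₀.im = 0 then 2 else 1) + analyticOrderAt ψ z₀ := by
  have han : AnalyticAt ℂ (spherePoly z₀) z₀ := by unfold spherePoly; fun_prop
  have hev : φ =ᶠ[𝓝 z₀] spherePoly z₀ ^ k * ψ := by
    filter_upwards [hD.mem_nhds hz₀] with z hz using h z hz
  rw [analyticOrderAt_congr hev, analyticOrderAt_mul (han.pow k) (hψ.analyticOnNhd hD z₀ hz₀),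
    analyticOrderAt_pow han, analyticOrderAt_spherePoly, nsmul_eq_mul]

theorem StemHasMultiplicities.Phi_eq {z₀ : ℂ} {m n : ℕ} (h : StemHasMultiplicities D F z₀ m n) :
    ∃ G, IsStem D G ∧ Phi (G z₀) ≠ 0 ∧
      ∀ z ∈ D, Phi (F z) = spherePoly z₀ z ^ (2 * m + n) * Phi (G z) := by
  obtain ⟨ps, G, hn, hps, -, -, hG, hG0, hF⟩ := h
  refine ⟨G, hG, hG0, fun z hz => ?_⟩
  rw [hF z hz, Phi_smul, Phi_mul, Phi_linProd hps, hn]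
  ring

/-- `Φ ∘ F` vanishes at `z₀` to the order `2 m + n`, doubled at a real point. -/
theorem StemHasMultiplicities.analyticOrderAt_eq (hD : IsOpen D) {z₀ : ℂ} (hz₀ : z₀ ∈ D) {m n : ℕ}
    (h : StemHasMultiplicities D F z₀ m n) :
    analyticOrderAt (fun z => Phi (F z)) z₀ =
      ((2 * m + n) * (if z₀.im = 0 then 2 else 1) : ℕ) := by
  obtain ⟨G, hG, hG0, hF⟩ := h.Phi_eq
  have h0 : analyticOrderAt (fun z => Phi (G z)) z₀ = 0 :=
    (hG.differentiableOn_Phi.analyticOnNhd hD z₀ hz₀).analyticOrderAt_eq_zero.2 hG0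
  rw [analyticOrderAt_spherePoly_pow_mul hD hz₀ hG.differentiableOn_Phi hF, h0, add_zero]
  split_ifs <;> push_cast <;> rfl

theorem StemHasMultiplicities.analyticOrderAt_conj_eq (hD : IsOpen D) {z₀ : ℂ} (hz₀ : z₀ ∈ D)
    (hz₀' : conj z₀ ∈ D) {m n : ℕ} (h : StemHasMultiplicities D F z₀ m n) :
    analyticOrderAt (fun z => Phi (F z)) (conj z₀) =
      ((2 * m + n) * (if z₀.im = 0 then 2 else 1) : ℕ) := by
  obtain ⟨G, hG, hG0, hF⟩ := h.Phi_eq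
  have hG0' : Phi (G (conj z₀)) ≠ 0 := by
    rw [hG.symm z₀ hz₀, Phi_conjExt]
    exact (map_ne_zero _).2 hG0
  have h0 : analyticOrderAt (fun z => Phi (G z)) (conj z₀) = 0 :=
    (hG.differentiableOn_Phi.analyticOnNhd hD _ hz₀').analyticOrderAt_eq_zero.2 hG0'
  rw [analyticOrderAt_spherePoly_pow_mul hD hz₀' hG.differentiableOn_Phi
    (by simpa only [spherePoly_conj_left] using hF), h0, add_zero]
  simp only [Complex.conj_im, neg_eq_zero]
  split_ifs <;> push_cast <;> rfl

/-- At a non-real point where `F` does not vanish, linear factors are split off one by one until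
`Φ ∘ F` has no zero left. -/
theorem IsStem.exists_linProd (hD : IsOpen D) (hDs : ∀ z ∈ D, conj z ∈ D) {z₀ : ℂ} (hz₀ : z₀ ∈ D)
    (him : z₀.im ≠ 0) (k : ℕ) : ∀ F, IsStem D F →
      analyticOrderAt (fun z => Phi (F z)) z₀ = k → ∃ (ps : List ℍ) (G : ℂ → Quaternion ℂ),
        (∀ p ∈ ps, p ∈ sphereOf z₀) ∧ IsStem D G ∧ Phi (G z₀) ≠ 0 ∧
          ∀ z ∈ D, F z = linProd ps z * G z := by
  induction k with
  | zero =>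
    intro F hF hk
    refine ⟨[], F, by simp, hF, ?_, fun z _ => by rw [linProd_nil, one_mul]⟩
    exact (hF.differentiableOn_Phi.analyticOnNhd hD z₀ hz₀).analyticOrderAt_eq_zero.1
      (by simpa using hk)
  | succ k ih =>
    intro F hF hk
    have hzero : Phi (F z₀) = 0 :=
      apply_eq_zero_of_analyticOrderAt_ne_zero (f := fun z => Phi (F z)) (by rw [hk]; simp)
    obtain ⟨p, hp, G, hG, hFG⟩ := hF.exists_eq_linFactor_mul hD hDs hz₀ him hzero
    have hord := analyticOrderAt_spherePoly_pow_mul (φ := fun z => Phi (F z)) (k := 1) hD hz₀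
      hG.differentiableOn_Phi (fun z hz => by
        simp only [hFG z hz]
        rw [Phi_mul, Phi_linFactor hp, pow_one])
    rw [hk, if_neg him] at hord
    have hG' : analyticOrderAt (fun z => Phi (G z)) z₀ = k := by
      rw [Nat.cast_succ, Nat.cast_one, one_mul, add_comm 1] at hord
      exact (ENat.add_left_injective_of_ne_top (by simp) hord).symm
    obtain ⟨ps, G', hps, hG'', hG0, hGG⟩ := ih G hG hG'
    refine ⟨p :: ps, G', ?_, hG'', hG0, fun z hz => ?_⟩
    · rintro q hq
      rcases List.mem_cons.1 hq with rfl | hq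
      exacts [hp, hps q hq]
    · rw [hFG z hz, hGG z hz, linProd_cons, mul_assoc]

theorem IsStem.exists_hasMultiplicities_of_im_ne_zero (hD : IsOpen D)
    (hDs : ∀ z ∈ D, conj z ∈ D) {z₀ : ℂ} (hz₀ : z₀ ∈ D) (him : z₀.im ≠ 0) (k : ℕ) :
    ∀ F, IsStem D F → analyticOrderAt (fun z => Phi (F z)) z₀ = k →
      ∃ m n, StemHasMultiplicities D F z₀ m n := by
  induction k using Nat.strong_induction_on with
  | _ k ih =>
    intro F hF hk
    by_cases h0 : F z₀ = 0
    · obtain ⟨G, hG, hFG⟩ := hF.exists_eq_spherePoly_smul hD hDs hz₀ him h0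
      have hord := analyticOrderAt_spherePoly_pow_mul (φ := fun z => Phi (F z)) (k := 2) hD hz₀
        hG.differentiableOn_Phi (fun z hz => by
          simp only [hFG z hz]
          rw [Phi_smul])
      rw [hk, if_neg him] at hord
      have hne : analyticOrderAt (fun z => Phi (G z)) z₀ ≠ ⊤ := fun h => by
        rw [h] at hord
        simp at hord
      obtain ⟨j, hj⟩ := ENat.ne_top_iff_exists.1 hne
      rw [← hj] at hord
      have hjk : k = 2 * 1 + j := by exact_mod_cast hord
      obtain ⟨m, n, ps, G', h1, h2, h3, -, h5, h6, h7⟩ := ih j (by omega) G hG hj.symm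
      refine ⟨m + 1, n, ps, G', h1, h2, h3, fun h => absurd h him, h5, h6, fun z hz => ?_⟩
      rw [hFG z hz, h7 z hz, smul_smul, pow_succ']
    · obtain ⟨ps, G, hps, hG, hG0, hFG⟩ := exists_linProd hD hDs hz₀ him k F hF hk
      refine ⟨0, ps.length, ps, G, rfl, hps, fun _ => isChain_of_linProd_mul_ne_zero hps
        (x := G z₀) (by rwa [← hFG z₀ hz₀]), fun h => absurd h him, hG, hG0, fun z hz => ?_⟩
      rw [pow_zero, one_smul, hFG z hz]

theorem linFactor_of_im_eq_zero {z₀ : ℂ} (him : z₀.im = 0) (z : ℂ) :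
    linFactor (z₀.re : ℍ) z = ((z - z₀ : ℂ) : Quaternion ℂ) := by
  have h : (z₀.re : ℂ) = z₀ := Complex.ext rfl (by simp [him])
  ext <;> simp [linFactor, h]

/-- At a real point, `Φ (F z₀)` is the squared norm of the quaternion `F z₀`. -/
theorem IsStem.eq_zero_of_Phi_eq_zero (hF : IsStem D F) {z₀ : ℂ} (hz₀ : z₀ ∈ D)
    (him : z₀.im = 0) (h : Phi (F z₀) = 0) : F z₀ = 0 := by
  obtain ⟨v, hv, hvF⟩ := exists_rhoExt_eq_zero h
  have h1 := hF.imExt_eq_zero hz₀ him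
  rw [rhoExt_eq, h1, mul_zero, add_zero] at hvF
  rw [eq_incl_add_smul_incl (F z₀), hvF, h1, map_zero, smul_zero, add_zero]

theorem IsStem.exists_hasMultiplicities_of_im_eq_zero (hD : IsOpen D)
    (hDs : ∀ z ∈ D, conj z ∈ D) {z₀ : ℂ} (hz₀ : z₀ ∈ D) (him : z₀.im = 0) (k : ℕ) :
    ∀ F, IsStem D F → analyticOrderAt (fun z => Phi (F z)) z₀ = k →
      ∃ n, StemHasMultiplicities D F z₀ 0 n := by
  have hmem : (z₀.re : ℍ) ∈ sphereOf z₀ := ⟨unitI, unitI_mem, by simp [rho, him]⟩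
  induction k using Nat.strong_induction_on with
  | _ k ih =>
    intro F hF hk
    by_cases h0 : Phi (F z₀) = 0
    · obtain ⟨G, hG, hFG⟩ := hF.exists_eq_sub_smul hD hDs hz₀ him
        (hF.eq_zero_of_Phi_eq_zero hz₀ him h0)
      have hord := analyticOrderAt_spherePoly_pow_mul (φ := fun z => Phi (F z)) (k := 1) hD hz₀
        hG.differentiableOn_Phi (fun z hz => by
          simp only [hFG z hz]
          rw [Phi_smul, spherePoly_eq_mul, Complex.conj_eq_iff_im.2 him, pow_one, pow_two])
      rw [hk, if_pos him] at hord
      have hne : analyticOrderAt (fun z => Phi (G z)) z₀ ≠ ⊤ := fun h => by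
        rw [h] at hord
        simp at hord
      obtain ⟨j, hj⟩ := ENat.ne_top_iff_exists.1 hne
      rw [← hj] at hord
      have hjk : k = 1 * 2 + j := by exact_mod_cast hord
      obtain ⟨n, ps, G', h1, h2, -, h4, h5, h6, h7⟩ := ih j (by omega) G hG hj.symm
      refine ⟨n + 1, z₀.re :: ps, G', by simp [h1], ?_, fun h => absurd him h, h4, h5, h6,
        fun z hz => ?_⟩
      · rintro q hq
        rcases List.mem_cons.1 hq with rfl | hq
        exacts [hmem, h2 q hq]
      · rw [hFG z hz, h7 z hz, linProd_cons, linFactor_of_im_eq_zero him, mul_assoc,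
          Quaternion.coe_mul_eq_smul, pow_zero, one_smul, one_smul]
    · exact ⟨0, [], F, rfl, by simp, fun h => absurd him h, fun _ => rfl, hF, h0,
        fun z _ => by rw [linProd_nil, one_mul, pow_zero, one_smul]⟩

/-- The spherical multiplicity is the order of vanishing of `F` at `z₀`. -/
theorem StemHasMultiplicities.spherical_le (hD : IsOpen D) {z₀ : ℂ} (hz₀ : z₀ ∈ D)
    (him : z₀.im ≠ 0) {m n m' n' : ℕ} (h : StemHasMultiplicities D F z₀ m n)
    (h' : StemHasMultiplicities D F z₀ m' n') : m' ≤ m := by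
  by_contra hlt
  push Not at hlt
  obtain ⟨ps, G, -, hps, hc, -, hG, hG0, hF⟩ := h
  obtain ⟨ps', G', -, -, -, -, hG', -, hF'⟩ := h'
  obtain ⟨d, rfl⟩ := Nat.exists_eq_add_of_lt hlt
  refine linProd_mul_ne_zero him hps (hc him) hG0 (ext_coord fun i => ?_)
  have hcont := ((isStem_linProd_mul ps' hG').continuousAt_coord hD hz₀ i)
  have hs : ContinuousAt (fun z => spherePoly z₀ z ^ (d + 1)) z₀ := by unfold spherePoly; fun_prop
  rw [eq_of_eventuallyEq_punctured ((isStem_linProd_mul ps hG).continuousAt_coord hD hz₀ i)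
    (hs.mul hcont), Pi.mul_apply, spherePoly_self, coord_zero_right]
  · simp
  filter_upwards [eventually_spherePoly_ne_zero z₀ z₀, nhdsWithin_le_nhds (hD.mem_nhds hz₀)]
    with z hz hzD
  have h1 := congrArg (coord i) ((hF z hzD).symm.trans (hF' z hzD))
  rw [coord_smul, coord_smul, add_assoc, pow_add, mul_assoc] at h1
  exact mul_left_cancel₀ (pow_ne_zero _ hz) h1

theorem StemHasMultiplicities.unique (hD : IsOpen D) {z₀ : ℂ} (hz₀ : z₀ ∈ D)
    {m n m' n' : ℕ} (h : StemHasMultiplicities D F z₀ m n)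
    (h' : StemHasMultiplicities D F z₀ m' n') : m' = m ∧ n' = n := by
  have hord := (h.analyticOrderAt_eq hD hz₀).symm.trans (h'.analyticOrderAt_eq hD hz₀)
  have hm : m' = m := by
    by_cases him : z₀.im = 0
    · obtain ⟨_, _, -, -, -, h1, -⟩ := h
      obtain ⟨_, _, -, -, -, h2, -⟩ := h'
      rw [h1 him, h2 him]
    · exact le_antisymm (h.spherical_le hD hz₀ him h') (h'.spherical_le hD hz₀ him h)
  rw [Nat.cast_inj] at hord
  refine ⟨hm, ?_⟩
  split_ifs at hord <;> omega

/-! ### Counting zeros -/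

variable {V : Set ℂ}

theorem rho_mem_circularization_iff (hV : ∀ z ∈ V, conj z ∈ V) {v : ℍ} (hv : v ∈ imagUnits)
    {z : ℂ} : rho v z ∈ circularization V ↔ z ∈ V := by
  constructor
  · rintro ⟨w, hw, v', hv', h⟩
    rcases eq_or_eq_conj_of_rho_eq hv hv' h with rfl | rfl
    exacts [hw, hV _ hw]
  · exact fun hz => ⟨z, hz, v, hv, rfl⟩

theorem continuous_rho (v : ℍ) : Continuous (rho v) := by
  have h1 : Continuous fun z : ℂ => (z.re : ℍ) :=
    Quaternion.continuous_coe.comp Complex.continuous_re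
  have h2 : Continuous fun z : ℂ => (z.im : ℍ) :=
    Quaternion.continuous_coe.comp Complex.continuous_im
  exact h1.add (continuous_const.mul h2)

theorem rho_mem_closure_circularization {v : ℍ} (hv : v ∈ imagUnits) {z : ℂ}
    (hz : z ∈ closure V) : rho v z ∈ closure (circularization V) :=
  map_mem_closure (continuous_rho v) hz fun w hw => ⟨w, hw, v, hv, rfl⟩

theorem closure_subset_of_closure_circularization_subset (hD : ∀ z ∈ D, conj z ∈ D)
    (hVD : closure (circularization V) ⊆ circularization D) : closure V ⊆ D := fun _ hz =>
  (rho_mem_circularization_iff hD unitI_mem).1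
    (hVD (rho_mem_closure_circularization unitI_mem hz))

theorem rho_mem_frontier_circularization (hV : IsOpen V) (hVs : ∀ z ∈ V, conj z ∈ V) {v : ℍ}
    (hv : v ∈ imagUnits) {z : ℂ} (hz : z ∈ frontier V) :
    rho v z ∈ frontier (circularization V) := by
  rw [hV.frontier_eq] at hz
  exact ⟨rho_mem_closure_circularization hv hz.1, fun h =>
    hz.2 ((rho_mem_circularization_iff hVs hv).1 (interior_subset h))⟩

theorem mem_zeroSpheres_iff (hDs : ∀ z ∈ D, conj z ∈ D) (hVD : V ⊆ D)
    (hf : IsSliceRegularOn D f) {z : ℂ} :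
    z ∈ zeroSpheres f V ↔ (z ∈ V ∧ Phi (stem f z) = 0) ∧ 0 ≤ z.im := by
  have h : z ∈ V → ((∃ q ∈ sphereOf z, f q = 0) ↔ Phi (stem f z) = 0) := fun hz => by
    rw [← not_iff_not, ← ne_eq (Phi _),
      ← (hf.represents_stem hDs).forall_sphereOf_ne_zero_iff (hVD hz)]
    push Not
    rfl
  constructor
  · rintro ⟨hz, him, hq⟩
    exact ⟨⟨hz, (h hz).1 hq⟩, him⟩
  · rintro ⟨⟨hz, hq⟩, him⟩
    exact ⟨hz, him, (h hz).2 hq⟩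

theorem existsUnique_hasMultiplicities (hD : IsOpen D) (hDs : ∀ z ∈ D, conj z ∈ D)
    (hf : IsSliceRegularOn D f) {z : ℂ} (hz : z ∈ D)
    (hord : analyticOrderAt (fun z => Phi (stem f z)) z ≠ ⊤) :
    ∃! mn : ℕ × ℕ, HasMultiplicities D f z mn.1 mn.2 := by
  obtain ⟨k, hk⟩ := ENat.ne_top_iff_exists.1 hord
  have hex : ∃ m n, StemHasMultiplicities D (stem f) z m n := by
    by_cases him : z.im = 0
    · exact ⟨0, IsStem.exists_hasMultiplicities_of_im_eq_zero hD hDs hz him k _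
        (hf.isStem_stem hD hDs) hk.symm⟩
    · exact IsStem.exists_hasMultiplicities_of_im_ne_zero hD hDs hz him k _
        (hf.isStem_stem hD hDs) hk.symm
  simp only [hasMultiplicities_iff hD hDs (hf.represents_stem hDs) hz]
  obtain ⟨m, n, h⟩ := hex
  refine ⟨(m, n), h, fun mn h' => ?_⟩
  obtain ⟨h1, h2⟩ := h.unique hD hz h'
  exact Prod.ext h1 h2

/-- The supremum of the admissible multiplicities is attained, as there is only one. -/
theorem hasMultiplicities_of_existsUnique {z : ℂ}
    (h : ∃! mn : ℕ × ℕ, HasMultiplicities D f z mn.1 mn.2) :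
    HasMultiplicities D f z (sphericalMultiplicity D f z) (isolatedMultiplicity D f z) := by
  obtain ⟨⟨m, n⟩, h1, h2⟩ := h
  have hm : {m | ∃ n, HasMultiplicities D f z m n} = {m} := by
    ext m'
    exact ⟨fun ⟨n', h'⟩ => congrArg Prod.fst (h2 (m', n') h'), fun h => ⟨n, by rw [h]; exact h1⟩⟩
  have hn : {n | ∃ m, HasMultiplicities D f z m n} = {n} := by
    ext n'
    exact ⟨fun ⟨m', h'⟩ => congrArg Prod.snd (h2 (m', n') h'), fun h => ⟨m, by rw [h]; exact h1⟩⟩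
  rw [sphericalMultiplicity, isolatedMultiplicity, hm, hn, csSup_singleton, csSup_singleton]
  exact h1

/-- Summation over a finite set symmetric under conjugation, by pairs of conjugate points. -/
theorem sum_eq_sum_filter_add_conj (Z : Finset ℂ) (hZ : ∀ z ∈ Z, conj z ∈ Z) (o : ℂ → ℕ) :
    ∑ z ∈ Z, o z =
      ∑ z ∈ Z.filter (fun z => 0 ≤ z.im), (o z + if z.im = 0 then 0 else o (conj z)) := by
  rw [Finset.sum_add_distrib, ← Finset.sum_filter_add_sum_filter_not Z (fun z => 0 ≤ z.im)]
  congr 1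
  have h1 : ∑ z ∈ Z.filter (fun z => 0 ≤ z.im), (if z.im = 0 then 0 else o (conj z)) =
      ∑ z ∈ (Z.filter (fun z => 0 ≤ z.im)).filter (fun z => ¬ z.im = 0), o (conj z) := by
    rw [Finset.sum_filter (fun z : ℂ => ¬ z.im = 0)]
    exact Finset.sum_congr rfl fun z _ => by split_ifs <;> rfl
  rw [h1]
  refine Finset.sum_nbij' (fun z => conj z) (fun z => conj z) ?_ ?_ ?_ ?_ ?_
  · intro z hz
    simp only [Finset.mem_filter, not_le, Complex.conj_im] at hz ⊢
    exact ⟨⟨hZ z hz.1, by linarith [hz.2]⟩, by linarith [hz.2]⟩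
  · intro z hz
    simp only [Finset.mem_filter, not_le, Complex.conj_im] at hz ⊢
    exact ⟨hZ z hz.1.1, by have := lt_of_le_of_ne hz.1.2 (Ne.symm hz.2); linarith⟩
  · exact fun z _ => Complex.conj_conj z
  · exact fun z _ => Complex.conj_conj z
  · exact fun z _ => by rw [Complex.conj_conj]

end SliceRegular

end

open SliceRegular in
theorem mainTheorem4
    (D V : Set ℂ) (hDopen : IsOpen D) (hDsymm : ∀ z ∈ D, conj z ∈ D)
    (hVopen : IsOpen V) (hVsymm : ∀ z ∈ V, conj z ∈ V)
    (hVD : closure (circularization V) ⊆ circularization D)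
    (f : ℍ → ℍ) (hf : IsSliceRegularOn D f)
    (hbd : ∀ q ∈ frontier (circularization V), f q ≠ 0)
    (N : ℕ) (Γ : Fin N → ℝ → ℂ) (hΓ : IsOrientedBoundary Γ V) :
    (zeroSpheres f V).Finite ∧
    (∀ z ∈ zeroSpheres f V, ∃! mn : ℕ × ℕ, HasMultiplicities D f z mn.1 mn.2) ∧
    (2 * Real.pi * Complex.I)⁻¹ *
        cycleIntegral Γ (fun z => deriv (Phi ∘ stem f) z / (Phi ∘ stem f) z) =
      2 * (isolatedZeroCount D f V : ℂ) + 4 * (sphericalZeroCount D f V : ℂ) := by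
  have hcl : closure V ⊆ D := closure_subset_of_closure_circularization_subset hDsymm hVD
  have hsub : V ⊆ D := subset_closure.trans hcl
  have hF := hf.isStem_stem hDopen hDsymm
  have hrep := hf.represents_stem hDsymm
  have hφ : DifferentiableOn ℂ (Phi ∘ stem f) D := hF.differentiableOn_Phi
  have h0 : ∀ z ∈ frontier V, (Phi ∘ stem f) z ≠ 0 := fun z hz =>
    (hrep.forall_sphereOf_ne_zero_iff (hcl (frontier_subset_closure hz))).1 (by
      rintro _ ⟨v, hv, rfl⟩
      exact hbd _ (rho_mem_frontier_circularization hVopen hVsymm hv hz))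
  have hb := hΓ.isBounded
  have hfin := finite_zeros_of_ne_zero_on_frontier hDopen hVopen hb hcl hφ h0
  have hmem := fun z => mem_zeroSpheres_iff (z := z) hDsymm hsub hf
  have hzs : (zeroSpheres f V).Finite := hfin.subset fun z hz => ((hmem z).1 hz).1
  have huniq : ∀ z ∈ zeroSpheres f V, ∃! mn : ℕ × ℕ, HasMultiplicities D f z mn.1 mn.2 :=
    fun z hz => existsUnique_hasMultiplicities hDopen hDsymm hf (hsub hz.1)
      (analyticOrderAt_ne_top_of_ne_zero_on_frontier hDopen hVopen hb hcl hφ h0 hz.1)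
  refine ⟨hzs, huniq, ?_⟩
  rw [hΓ.argument_principle hDopen hVopen hcl hφ h0 hfin.toFinset fun z => by simp,
    isolatedZeroCount, sphericalZeroCount, finsum_mem_eq_finite_toFinset_sum _ hzs,
    finsum_mem_eq_finite_toFinset_sum _ hzs]
  have hS : hzs.toFinset = hfin.toFinset.filter (fun z => 0 ≤ z.im) := by
    ext z
    rw [Set.Finite.mem_toFinset, Finset.mem_filter, Set.Finite.mem_toFinset, hmem]
    rfl
  have hsum : ∑ a ∈ hfin.toFinset, analyticOrderNatAt (Phi ∘ stem f) a =
      2 * ∑ z ∈ hzs.toFinset, isolatedMultiplicity D f z +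
        4 * ∑ z ∈ hzs.toFinset, sphericalMultiplicity D f z := by
    rw [sum_eq_sum_filter_add_conj, ← hS, Finset.mul_sum, Finset.mul_sum,
      ← Finset.sum_add_distrib]
    · refine Finset.sum_congr rfl fun z hz => ?_
      have hz' := hzs.mem_toFinset.1 hz
      have hzD := hsub hz'.1
      have hm := (hasMultiplicities_iff hDopen hDsymm hrep hzD).1
        (hasMultiplicities_of_existsUnique (huniq z hz'))
      have ho := hm.analyticOrderAt_eq hDopen hzD
      have ho' := hm.analyticOrderAt_conj_eq hDopen hzD (hDsymm z hzD)
      obtain ⟨-, -, -, -, -, him, -⟩ := hm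
      have e1 := congrArg ENat.toNat ho
      have e2 := congrArg ENat.toNat ho'
      rw [ENat.toNat_natCast] at e1 e2
      change analyticOrderNatAt (Phi ∘ stem f) _ = _ at e1
      change analyticOrderNatAt (Phi ∘ stem f) _ = _ at e2
      rw [e1, e2]
      -- A real point has no spherical multiplicity, and its order counts twice already.
      split_ifs with hreal
      · rw [him hreal]
        ring
      · ring
    · intro z hz
      rw [Set.Finite.mem_toFinset] at hz ⊢
      refine ⟨hVsymm z hz.1, ?_⟩
      rw [Function.comp_apply, hF.symm z (hsub hz.1), Phi_conjExt,
        show Phi (stem f z) = 0 from hz.2, map_zero]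
  exact_mod_cast hsum
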